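/- Let $\rho$ be a density matrix on $\mathbb{C}^d$. There are projection-valued measures $M^{(l)}=\{M^{(l)}_x\}_x$ on $(\mathbb{C}^d)^{\otimes l}$, $l=0,1,2,\dots$, each with finitely many outcomes and depending only on $\rho$ and $l$, with the following property. Let $\sigma\neq\rho$ be a density matrix on $\mathbb{C}^d$ with $D(\sigma\|\rho)=\mathrm{tr}[\sigma(\log\sigma-\log\rho)]<\infty$, i.e. $\mathrm{supp}\,\sigma\subseteq\mathrm{supp}\,\rho$. For a change point $\nu\in\{0,1,2,\dots\}\cup\{\infty\}$, consider the sequence of independent copies whose $n$-th copy is in the state $\rho$ if $n\le\nu$ and in the state $\sigma$ if $n>\nu$. For $l\ge 1$ and $h\ge 0$, the QUSUM algorithm with block length $l$ and threshold $h$ measures every successive block of $l$ copies with $M^{(l)}$, obtaining outcomes $x_1,x_2,\dots$; it puts $Z_i=\log\frac{\mathrm{tr}[M^{(l)}_{x_i}\sigma^{\otimes l}]}{\mathrm{tr}[M^{(l)}_{x_i}\rho^{\otimes l}]}$ and raises the alarm after $T=l\,T^\star$ copies, where $T^\star=\min\{n\ge 1:\ \sum_{i=j}^{n}Z_i\ge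 h\text{ for some }1\le j\le n\}$ is the CUSUM stopping time. Let $P_\nu,\mathbb{E}_\nu$ be probability and expectation when the change point is $\nu$, let $\bar T_{\mathrm{FA}}=\mathbb{E}_\infty[T]$ be the mean false alarm time, and let $$\bar\tau^\star=\sup_{\nu\ge 0}\ \sup_{x^\nu:\,P_\infty(X^\nu=x^\nu)>0}\mathbb{E}_\nu[T-\nu\mid T>\nu,\ X^\nu=x^\nu]$$ be the worst-worst-case mean delay, where $0\le\nu<\infty$ is not required to be a multiple of $l$ and $X^\nu$ is the record of the outcomes of the $\lfloor\nu/l\rfloor$ blocks completed within the first $\nu$ copies (conditioning events of probability zero are disregarded). Then for every $0<\epsilon<1$ there are a block length $l\ge 1$ and constants $C,T_0\in\mathbb{R}$ such that: (a) for every threshold $h\ge 0$, QUSUM has $\bar T_{\mathrm{FA}}<\infty$ and $\bar\tau^\star\le\frac{\log\bar T_{\mathrm{FA}}}{D(\sigma\|\rho)(1-\epsilon)}+C$; (b) for every $\bar T\ge T_0$ there is a threshold $h\ge 0$ for which QUSUM has $\bar T_{\mathrm{FA}}\ge\bar T$ and $\bar\tau^\star\le\frac{\log\bar T}{D(\sigma\|\rho)(1-\epsilon)}+C$.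 -/

import Mathlib

open MeasureTheory ProbabilityTheory
open scoped ENNReal Matrix ComplexOrder

namespace QuantumChangePoint

/-- A state (density matrix) on a finite-dimensional Hilbert space with orthonormal basis
indexed by `n`. -/
structure DensityMatrix (n : Type) [Fintype n] where
  val : Matrix n n ℂ
  posSemidef : val.PosSemidef
  trace_eq_one : val.trace = 1

/-- A projection-valued measure with outcomes in `X`: pairwise orthogonal orthogonal projections
summing to the identity. -/
structure PVM (n : Type) [Fintype n] [DecidableEq n] (X : Type) [Fintype X] where
  proj : X → Matrix n n ℂ
  isStarProjection : ∀ x, IsStarProjection (proj x)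
  orthogonal : ∀ x y, x ≠ y → proj x * proj y = 0
  sum_eq_one : ∑ x, proj x = 1

open Classical in
/-- The quantum relative entropy `D(σ‖ρ) = tr[σ (log σ - log ρ)]` (natural logarithm, with
`log 0 = 0` on the kernels) if `supp σ ⊆ supp ρ`, equivalently `ker ρ ⊆ ker σ`, and `⊤`
otherwise. -/
noncomputable def relEntropy {n : Type} [Fintype n] [DecidableEq n]
    (σ ρ : DensityMatrix n) : EReal :=
  if ∀ v : n → ℂ, ρ.val *ᵥ v = 0 → σ.val *ᵥ v = 0 then
    (((σ.val * (cfc Real.log σ.val - cfc Real.log ρ.val)).trace.re : ℝ) : EReal)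
  else ⊤

/-- The matrix of `A 0 ⊗ A 1 ⊗ ⋯ ⊗ A (l - 1)` in the product basis. -/
def tensorMatrix {d l : ℕ} (A : Fin l → Matrix (Fin d) (Fin d) ℂ) :
    Matrix (Fin l → Fin d) (Fin l → Fin d) ℂ :=
  fun i j => ∏ k, A k (i k) (j k)

theorem tensorMatrix_mul {d l : ℕ} (A B : Fin l → Matrix (Fin d) (Fin d) ℂ) :
    tensorMatrix (fun k => A k * B k) = tensorMatrix A * tensorMatrix B := by
  ext i j
  simp only [tensorMatrix, Matrix.mul_apply, ← Finset.prod_mul_distrib]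
  rw [Finset.prod_univ_sum, Fintype.piFinset_univ]

theorem tensorMatrix_conjTranspose {d l : ℕ} (A : Fin l → Matrix (Fin d) (Fin d) ℂ) :
    tensorMatrix (fun k => (A k)ᴴ) = (tensorMatrix A)ᴴ := by
  ext i j
  simp [tensorMatrix, Matrix.conjTranspose_apply]

open scoped MatrixOrder Matrix.Norms.L2Operator in
theorem exists_conjTranspose_mul_self {n : Type} [Fintype n] [DecidableEq n] {A : Matrix n n ℂ}
    (hA : A.PosSemidef) : ∃ B : Matrix n n ℂ, A = Bᴴ * B :=
  CStarAlgebra.nonneg_iff_eq_star_mul_self.mp hA.nonneg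

/-- The product state `τ 0 ⊗ τ 1 ⊗ ⋯ ⊗ τ (l - 1)`. -/
def tensorState {d l : ℕ} (τ : Fin l → DensityMatrix (Fin d)) :
    DensityMatrix (Fin l → Fin d) where
  val := tensorMatrix fun k => (τ k).val
  posSemidef := by
    have h : ∀ k, ∃ B : Matrix (Fin d) (Fin d) ℂ, (τ k).val = Bᴴ * B := fun k =>
      exists_conjTranspose_mul_self (τ k).posSemidef
    choose B hB using h
    have : (fun k => (τ k).val) = fun k => (B k)ᴴ * B k := funext hB
    rw [this, tensorMatrix_mul, tensorMatrix_conjTranspose]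
    exact Matrix.posSemidef_conjTranspose_mul_self _
  trace_eq_one := by
    have h := Finset.prod_univ_sum (fun _ : Fin l => (Finset.univ : Finset (Fin d)))
      (fun k i => (τ k).val i i)
    rw [Fintype.piFinset_univ] at h
    have h1 : ∀ k, ∑ i, (τ k).val i i = 1 := fun k => (τ k).trace_eq_one
    simp only [h1, Finset.prod_const_one] at h
    exact h.symm

/-- The probability `tr[M_x τ]` of the outcome `x` when the state `τ` is measured with `M`. -/
noncomputable def outcomeProb {n X : Type} [Fintype n] [DecidableEq n] [Fintype X]
    (M : PVM n X) (τ : DensityMatrix n) (x : X) : ℝ≥0∞ :=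
  ENNReal.ofReal (M.proj x * τ.val).trace.re

theorem sum_outcomeProb {n X : Type} [Fintype n] [DecidableEq n] [Fintype X]
    (M : PVM n X) (τ : DensityMatrix n) : ∑ x, outcomeProb M τ x = 1 := by
  have h0 : ∀ x, 0 ≤ (M.proj x * τ.val).trace.re := by
    intro x
    have e : (M.proj x * τ.val).trace = (M.proj x * τ.val * (M.proj x)ᴴ).trace := by
      rw [Matrix.trace_mul_comm (M.proj x * τ.val), ← Matrix.mul_assoc,
        show (M.proj x)ᴴ = M.proj x from (M.isStarProjection x).isSelfAdjoint,
        (M.isStarProjection x).isIdempotentElem]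
    rw [e]
    have := (τ.posSemidef.mul_mul_conjTranspose_same (M.proj x)).trace_nonneg
    exact (Complex.le_def.mp this).1
  simp only [outcomeProb]
  rw [← ENNReal.ofReal_sum_of_nonneg (fun x _ => h0 x), ← Complex.re_sum, ← Matrix.trace_sum,
    ← Finset.sum_mul, M.sum_eq_one, Matrix.one_mul, τ.trace_eq_one]
  simp

/-- The distribution of the outcome when the state `τ` is measured with `M`. -/
noncomputable def outcomePMF {n X : Type} [Fintype n] [DecidableEq n] [Fintype X]
    (M : PVM n X) (τ : DensityMatrix n) : PMF X :=
  PMF.ofFintype (outcomeProb M τ) (sum_outcomeProb M τ)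

/-- The change point sequence: the copies number `1, …, ν` are in the state `ρ` and all later
ones are in the state `σ`; `ν = ⊤` means that there is no change. -/
def copyState {d : ℕ} (ρ σ : DensityMatrix (Fin d)) (ν : ℕ∞) (i : ℕ) : DensityMatrix (Fin d) :=
  if (i : ℕ∞) ≤ ν then ρ else σ

/-- The state of the block number `k` (`k = 0, 1, …`) of `l` consecutive copies, which consists of
the copies number `k * l + 1, …, k * l + l`; the change may happen inside the block. -/
def blockState {d : ℕ} (ρ σ : DensityMatrix (Fin d)) (l : ℕ) (ν : ℕ∞) (k : ℕ) :
    DensityMatrix (Fin l → Fin d) :=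
  tensorState fun r : Fin l => copyState ρ σ ν (k * l + r + 1)

/-- The law `P_ν` of the sequence of outcomes obtained by measuring each block with `M`, when the
change point is at `ν` (`P_∞` for `ν = ⊤`). -/
noncomputable def outcomeLaw {d l m : ℕ} (M : PVM (Fin l → Fin d) (Fin m))
    (ρ σ : DensityMatrix (Fin d)) (ν : ℕ∞) : Measure (ℕ → Fin m) :=
  Measure.infinitePi fun k => (outcomePMF M (blockState ρ σ l ν k)).toMeasure

/-- The log-likelihood ratio `log (q(x) / p(x))` of a block outcome, where `q` and `p` are its
distributions on `σ^{⊗ l}` and on `ρ^{⊗ l}`; it is `⊥` if `q(x) = 0`. -/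
noncomputable def logLikelihoodRatio {d l m : ℕ} (M : PVM (Fin l → Fin d) (Fin m))
    (ρ σ : DensityMatrix (Fin d)) (x : Fin m) : EReal :=
  ENNReal.log (outcomeProb M (tensorState fun _ : Fin l => σ) x /
    outcomeProb M (tensorState fun _ : Fin l => ρ) x)

/-- The one-sided test started after `j` blocks: the least number `n > j` of measured blocks such
that the log-likelihood ratios of the outcomes number `j, …, n - 1` (counted from `0`) add up to
at least `h`; it is `⊤` if there is none. -/
noncomputable def oneSidedTime {d l m : ℕ} (M : PVM (Fin l → Fin d) (Fin m))
    (ρ σ : DensityMatrix (Fin d)) (h : ℝ) (j : ℕ) (x : ℕ → Fin m) : ℕ∞ :=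
  ⨅ (n : ℕ) (_ : j < n ∧ (h : EReal) ≤ ∑ i ∈ Finset.Ico j n, logLikelihoodRatio M ρ σ (x i)),
    (n : ℕ∞)

/-- The CUSUM stopping time on the sequence of block outcomes, counted in blocks. -/
noncomputable def cusumTime {d l m : ℕ} (M : PVM (Fin l → Fin d) (Fin m))
    (ρ σ : DensityMatrix (Fin d)) (h : ℝ) (x : ℕ → Fin m) : ℕ∞ :=
  ⨅ j : ℕ, oneSidedTime M ρ σ h j x

/-- The alarm time `T` of the QUSUM algorithm with block measurement `M` on `l` copies and
threshold `h`, counted in copies received. -/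
noncomputable def qusumTime {d l m : ℕ} (M : PVM (Fin l → Fin d) (Fin m))
    (ρ σ : DensityMatrix (Fin d)) (h : ℝ) (x : ℕ → Fin m) : ℝ≥0∞ :=
  (l : ℝ≥0∞) * (cusumTime M ρ σ h x : ℝ≥0∞)

/-- The mean false alarm time `E_∞[T]` of the QUSUM algorithm. -/
noncomputable def meanFalseAlarmTime {d l m : ℕ} (M : PVM (Fin l → Fin d) (Fin m))
    (ρ σ : DensityMatrix (Fin d)) (h : ℝ) : ℝ≥0∞ :=
  ∫⁻ x, qusumTime M ρ σ h x ∂(outcomeLaw M ρ σ ⊤)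

/-- The event that the outcomes of the blocks completed within the first `ν` copies
are given by `y`. -/
def recordEvent {m : ℕ} (l ν : ℕ) (y : Fin (ν / l) → Fin m) : Set (ℕ → Fin m) :=
  {x | ∀ k : Fin (ν / l), x k = y k}

/-- The worst-worst-case mean delay
`sup_ν sup_{x^ν, P_∞(X^ν = x^ν) > 0} E_ν[T - ν | T > ν, X^ν = x^ν]` of the QUSUM algorithm, over
all `ν ≥ 0`, also those that are not multiples of `l`. The record `X^ν` after `ν` copies consists
of the outcomes of the `ν / l` completed blocks. -/
noncomputable def worstMeanDelay {d l m : ℕ} (M : PVM (Fin l → Fin d) (Fin m))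
    (ρ σ : DensityMatrix (Fin d)) (h : ℝ) : ℝ≥0∞ :=
  ⨆ (ν : ℕ) (y : Fin (ν / l) → Fin m) (_ : 0 < outcomeLaw M ρ σ ⊤ (recordEvent l ν y)),
    ∫⁻ x, (qusumTime M ρ σ h x - (ν : ℝ≥0∞))
      ∂(cond (outcomeLaw M ρ σ (ν : ℕ∞))
        ({x | (ν : ℝ≥0∞) < qusumTime M ρ σ h x} ∩ recordEvent l ν y))

end QuantumChangePoint

/-! The proof has a classical half, about CUSUM on the block outcomes, and a quantum half, which
finds measurements whose outcome divergence per copy is close to D(σ‖ρ) although they do not know σ.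

Classical half. Let p and q be the outcome distributions of a block on ρ^{⊗l} and σ^{⊗l}, and let I
= D(q‖p), which is `measuredEntropy`. Under p the likelihood ratio has mean one, so Ville's
inequality and a union bound over the starting points of the one-sided tests give a mean false alarm
time of at least e^h/4 (`le_meanFalseAlarmTime`). After the change the log-likelihood walk has drift
I, and Wald's identity bounds its mean passage time over h by (h + B)/I blocks, where B bounds one
increment. The block that may contain the change is skipped, at the cost of one block
(`worstMeanDelay_le`). If I ≥ lD, the delay is at most h/D plus a constant, while h is at most the
logarithm of the false alarm time plus log 4 (`exists_constants`).

Quantum half. In a product eigenbasis of ρ, the eigenvalue of ρ^{⊗l} at a word depends only on the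
letter counts of the word, which take at most (l+1)^d values. Pinching σ^{⊗l} to the corresponding
blocks makes it commute with ρ^{⊗l} and raises its entropy by at most d log(l+1). Measuring in a
common eigenbasis therefore gives I ≥ l D(σ‖ρ) − d log(l+1) (`exists_measuredEntropy_ge`), and the
loss is o(l).

Universality. That eigenbasis depends on σ. For a fixed measurement the outcome divergence is
continuous in σ, so by the Lindelöf property countably many measurements serve all σ. Each of them
is repeated over a multiple of its own block length, and the multiples are chosen distinct, so that
every length carries a single measurement (`exists_measurements_lt_measuredEntropy`). -/

namespace QuantumChangePoint

/-! ### Independent outcomes and Ville's inequality. -/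

section Sequences

variable {X : Type*}

theorem DependsOn.comp₂ {β γ δ : Type*} {f : (ℕ → X) → β} {g : (ℕ → X) → γ} {s : Set ℕ}
    (hf : DependsOn f s) (hg : DependsOn g s) (op : β → γ → δ) :
    DependsOn (fun x => op (f x) (g x)) s :=
  fun x y h => by simp only [hf h, hg h]

theorem dependsOn_indicator {A : Set (ℕ → X)} {s : Set ℕ} (hA : DependsOn (· ∈ A) s)
    {f : (ℕ → X) → ℝ} (hf : DependsOn f s) : DependsOn (A.indicator f) s := by
  classical
  intro x y h
  have h1 : (x ∈ A) = (y ∈ A) := hA h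
  simp only [Set.indicator_apply, h1, hf h]

theorem dependsOn_prod {M : Type*} [CommMonoid M] (g : X → M) (j n : ℕ) :
    DependsOn (fun x : ℕ → X => ∏ i ∈ Finset.Ico j n, g (x i)) (Set.Iio n) :=
  fun x y h => Finset.prod_congr rfl fun i hi => by rw [h i (Finset.mem_Ico.mp hi).2]

/-- The sequences for which the products of `lam` over the outcomes number `j, …, k - 1` stay
below `c` for all `k ≤ n`. -/
def noHit (lam : X → ℝ) (c : ℝ) (j n : ℕ) : Set (ℕ → X) :=
  {x | ∀ k, j < k → k ≤ n → ∏ i ∈ Finset.Ico j k, lam (x i) < c}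

theorem dependsOn_noHit (lam : X → ℝ) (c : ℝ) (j n : ℕ) :
    DependsOn (· ∈ noHit lam c j n) (Set.Iio n) := by
  intro x y h
  refine forall_congr fun k => forall_congr fun _ => propext (forall_congr' fun hk => ?_)
  rw [Finset.prod_congr rfl fun i hi => by
    rw [h i (lt_of_lt_of_le (Finset.mem_Ico.mp hi).2 hk)]]

variable [MeasurableSpace X] [MeasurableSingletonClass X]

/-- The law of a sequence of independent outcomes with distributions `P 0, P 1, …`. -/
noncomputable def seqLaw (P : ℕ → PMF X) : Measure (ℕ → X) :=
  Measure.infinitePi fun k => (P k).toMeasure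

instance (P : ℕ → PMF X) : IsProbabilityMeasure (seqLaw P) := by
  unfold seqLaw; infer_instance

theorem ae_ne_of_apply_eq_zero (P : ℕ → PMF X) (k : ℕ) (a : X) (h : P k a = 0) :
    ∀ᵐ x ∂(seqLaw P), x k ≠ a := by
  have := (measurePreserving_eval_infinitePi (fun i => (P i).toMeasure) k)
  have h2 : (P k).toMeasure {a} = 0 := by
    rw [PMF.toMeasure_apply_singleton _ _ (measurableSet_singleton a), h]
  rw [← this.measure_preimage (measurableSet_singleton a).nullMeasurableSet] at h2
  exact measure_mono_null (fun x hx => by simpa using hx) h2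

variable [Fintype X]

/-- The alphabet is finite, so a function of finitely many outcomes factors through a finite
discrete space. Measurability and integrability of every event and variable below reduce to such
dependence. -/
theorem measurable_of_dependsOn {β : Type*} [MeasurableSpace β] {f : (ℕ → X) → β} {k : ℕ}
    (hf : DependsOn f (Set.Iio k)) : Measurable f := by
  rcases isEmpty_or_nonempty β with hβ | hβ
  · have : IsEmpty (ℕ → X) := ⟨fun x => hβ.false (f x)⟩
    exact measurable_of_empty f
  · obtain ⟨g, rfl⟩ := dependsOn_iff_exists_comp.mp hf
    exact (measurable_of_countable g).comp
      (measurable_pi_lambda _ fun i => measurable_pi_apply _)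

theorem integrable_of_dependsOn (P : ℕ → PMF X) {f : (ℕ → X) → ℝ} {k : ℕ}
    (hf : DependsOn f (Set.Iio k)) : Integrable f (seqLaw P) := by
  have hm := measurable_of_dependsOn hf
  obtain ⟨g, rfl⟩ := dependsOn_iff_exists_comp.mp hf
  have hfin : (Set.range g).Finite := Set.finite_range g
  obtain ⟨C, hC⟩ := (Set.finite_range fun z => ‖g z‖).bddAbove
  exact Integrable.of_bound hm.aestronglyMeasurable C
    (Filter.Eventually.of_forall fun x => hC ⟨_, rfl⟩)

/-- The outcome number `k` is independent of the previous ones. -/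
theorem integral_mul_of_dependsOn (P : ℕ → PMF X) {f : (ℕ → X) → ℝ} {k : ℕ}
    (hf : DependsOn f (Set.Iio k)) (g : X → ℝ) :
    ∫ x, f x * g (x k) ∂(seqLaw P) = (∫ x, f x ∂(seqLaw P)) * ∑ a, (P k a).toReal * g a := by
  obtain ⟨F, hF⟩ := dependsOn_iff_exists_comp.mp hf
  have hind : iIndepFun (fun i (x : ℕ → X) => x i) (seqLaw P) :=
    iIndepFun_infinitePi (P := fun i => (P i).toMeasure) (X := fun _ ω => ω)
      (fun _ => measurable_id)
  have h1 := (hind.indepFun_finset (Finset.range k) {k} (by simp)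
    (fun i => measurable_pi_apply i))
  let φ : (Finset.range k → X) → ℝ := fun z => F fun i => z ⟨i, Finset.mem_range.mpr i.2⟩
  let ψ : (({k} : Finset ℕ) → X) → ℝ := fun z => g (z ⟨k, by simp⟩)
  have h2 := (h1.comp (φ := φ) (ψ := ψ) (measurable_of_countable _)
    (measurable_of_countable _)).integral_fun_mul_eq_mul_integral
    ((measurable_of_countable φ).comp (measurable_pi_lambda _
      fun i => measurable_pi_apply _)).aestronglyMeasurable
    ((measurable_of_countable ψ).comp (measurable_pi_lambda _
      fun i => measurable_pi_apply _)).aestronglyMeasurable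
  have e1 : ∀ x, f x = (φ ∘ fun a (i : Finset.range k) => a i) x := fun x => by
    rw [hF]; rfl
  have e2 : ∫ x, g (x k) ∂(seqLaw P) = ∑ a, (P k a).toReal * g a := by
    have := (measurePreserving_eval_infinitePi (fun i => (P i).toMeasure) k)
    have h3 := PMF.integral_eq_sum (P k) g
    rw [← this.map_eq, integral_map this.measurable.aemeasurable
      (measurable_of_countable g).aestronglyMeasurable] at h3
    exact h3
  rw [← e2]
  simp only [e1]
  exact h2

theorem measurableSet_of_dependsOn {A : Set (ℕ → X)} {n : ℕ}
    (hA : DependsOn (· ∈ A) (Set.Iio n)) : MeasurableSet A :=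
  measurableSet_setOfPred.mpr (measurable_of_dependsOn hA)

/-- Ville's inequality for likelihood ratios. -/
theorem measureReal_compl_noHit_le (P : ℕ → PMF X) (lam : X → ℝ) {c : ℝ} (hc : 0 < c)
    (j n : ℕ) (hn : j ≤ n) (hlam : ∀ a, 0 ≤ lam a)
    (hP : ∀ i, j ≤ i → ∑ a, (P i a).toReal * lam a ≤ 1) :
    (seqLaw P).real (noHit lam c j n)ᶜ ≤ 1 / c := by
  classical
  let L : ℕ → (ℕ → X) → ℝ := fun n x => ∏ i ∈ Finset.Ico j n, lam (x i)
  have hL0 : ∀ n x, 0 ≤ L n x := fun n x => Finset.prod_nonneg fun i _ => hlam _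
  have hLdep : ∀ n, DependsOn (L n) (Set.Iio n) := fun n => dependsOn_prod lam j n
  -- The product is frozen at the value `c` once it has reached `c`. Discarding the overshoot only
  -- lowers it, so `Φ` is a supermartingale that starts at 1 and equals `c` on the event to be
  -- bounded; Markov's inequality then finishes.
  let Φ : ℕ → (ℕ → X) → ℝ := fun n x => if x ∈ noHit lam c j n then L n x else c
  have hdep : ∀ n, DependsOn (Φ n) (Set.Iio n) := by
    intro n x y h
    have h1 : (x ∈ noHit lam c j n) = (y ∈ noHit lam c j n) := dependsOn_noHit lam c j n h
    simp only [Φ, h1, hLdep n h]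
  have hΦ : ∀ n, j ≤ n → ∫ x, Φ n x ∂(seqLaw P) ≤ 1 := by
    intro n hn
    induction n, hn using Nat.le_induction with
    | base =>
      have : ∀ x, Φ j x = 1 := by
        intro x
        have : x ∈ noHit lam c j j := fun k h1 h2 => absurd (lt_of_lt_of_le h1 h2) (lt_irrefl _)
        simp [Φ, L, this]
      simp [this]
    | succ n hn ih =>
      have hpt : ∀ x, Φ (n + 1) x ≤
          Φ n x + (noHit lam c j n).indicator (L n) x * (lam (x n) - 1) := by
        intro x
        have hLs : L (n + 1) x = L n x * lam (x n) := Finset.prod_Ico_succ_top hn _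
        by_cases h1 : x ∈ noHit lam c j n
        · by_cases h2 : x ∈ noHit lam c j (n + 1)
          · simp only [Φ, h1, h2, if_true, Set.indicator_of_mem, hLs]
            linarith
          · have h3 : c ≤ L (n + 1) x := by
              by_contra h3
              push Not at h3
              refine h2 fun k hk1 hk2 => ?_
              rcases Nat.lt_or_ge k (n + 1) with h | h
              · exact h1 k hk1 (by omega)
              · rwa [le_antisymm hk2 h]
            simp only [Φ, h1, h2, if_true, if_false, Set.indicator_of_mem]
            linarith
        · have h2 : x ∉ noHit lam c j (n + 1) := fun h2 =>
            h1 fun k hk1 hk2 => h2 k hk1 (by omega)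
          simp [Φ, h1, h2]
      have hind : DependsOn ((noHit lam c j n).indicator (L n)) (Set.Iio n) :=
        dependsOn_indicator (dependsOn_noHit lam c j n) (hLdep n)
      have hmul : DependsOn (fun x => (noHit lam c j n).indicator (L n) x * (lam (x n) - 1))
          (Set.Iio (n + 1)) := by
        refine DependsOn.comp₂ (hind.mono (Set.Iio_subset_Iio n.le_succ)) ?_ _
        intro x y h
        simp only [h n (Set.mem_Iio.mpr n.lt_succ_self)]
      calc ∫ x, Φ (n + 1) x ∂(seqLaw P)
          ≤ ∫ x, (Φ n x + (noHit lam c j n).indicator (L n) x * (lam (x n) - 1))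
            ∂(seqLaw P) :=
            integral_mono (integrable_of_dependsOn P (hdep _))
              ((integrable_of_dependsOn P (hdep _)).add (integrable_of_dependsOn P hmul)) hpt
        _ = ∫ x, Φ n x ∂(seqLaw P) + (∫ x, (noHit lam c j n).indicator (L n) x ∂(seqLaw P)) *
            ∑ a, (P n a).toReal * (lam a - 1) := by
            rw [integral_add (integrable_of_dependsOn P (hdep _))
              (integrable_of_dependsOn P hmul),
              integral_mul_of_dependsOn P hind fun a => lam a - 1]
        _ ≤ 1 + 0 := by
            refine add_le_add ih (mul_nonpos_of_nonneg_of_nonpos ?_ ?_)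
            · exact integral_nonneg fun x => Set.indicator_nonneg (fun x _ => hL0 n x) x
            · have h1 : ∑ a, (P n a).toReal = 1 := by
                rw [← ENNReal.toReal_sum fun a _ => (P n).apply_ne_top a]
                have := (P n).tsum_coe
                rw [tsum_fintype] at this
                simp [this]
              simp only [mul_sub, Finset.sum_sub_distrib, mul_one, h1]
              linarith [hP n hn]
        _ = 1 := add_zero 1
  have hm : MeasurableSet (noHit lam c j n) :=
    measurableSet_of_dependsOn (dependsOn_noHit lam c j n)
  have h3 : ∫ x, (noHit lam c j n)ᶜ.indicator (fun _ => c) x ∂(seqLaw P) ≤ 1 := by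
    refine le_trans (integral_mono ?_ (integrable_of_dependsOn P (hdep n)) ?_) (hΦ n hn)
    · exact (integrable_const c).indicator hm.compl
    · intro x
      by_cases h1 : x ∈ noHit lam c j n
      · simp [Φ, h1, hL0]
      · simp [Φ, h1]
  rw [integral_indicator hm.compl, setIntegral_const, smul_eq_mul] at h3
  rwa [le_div_iff₀ hc]

end Sequences

/-! ### False alarms of CUSUM, and Wald's identity. -/

section Alarm

variable {X : Type*}

/-- The sequences without a CUSUM alarm among the first `n` outcomes. -/
def noAlarm (lam : X → ℝ) (c : ℝ) (n : ℕ) : Set (ℕ → X) :=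
  {x | ∀ j, x ∈ noHit lam c j n}

theorem dependsOn_noAlarm (lam : X → ℝ) (c : ℝ) (n : ℕ) :
    DependsOn (· ∈ noAlarm lam c n) (Set.Iio n) := by
  intro x y h
  exact forall_congr fun j => dependsOn_noHit lam c j n h

theorem noAlarm_anti (lam : X → ℝ) (c : ℝ) : Antitone (noAlarm lam c) :=
  fun _ _ h _ hx j k h1 h2 => hx j k h1 (h2.trans h)

/-- The expectation of an extended natural number valued `N` is the sum of the probabilities of
the events `n < N`. -/
theorem lintegral_enat_eq_tsum {Ω : Type*} [MeasurableSpace Ω] (μ : Measure Ω) (N : Ω → ℕ∞)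
    (A : ℕ → Set Ω) (hA : ∀ n, MeasurableSet (A n)) (hN : ∀ (n : ℕ) x, (n : ℕ∞) < N x ↔ x ∈ A n) :
    ∫⁻ x, (N x : ℝ≥0∞) ∂μ = ∑' n, μ (A n) := by
  classical
  have h : ∀ x, (N x : ℝ≥0∞) = ∑' n, (A n).indicator (fun _ => (1 : ℝ≥0∞)) x := by
    intro x
    have h1 : ∀ n, (A n).indicator (fun _ => (1 : ℝ≥0∞)) x = if (n : ℕ∞) < N x then 1 else 0 := by
      intro n
      simp only [Set.indicator_apply, hN]
    simp only [h1]
    rcases eq_or_ne (N x) ⊤ with h2 | h2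
    · simp [h2]
    · obtain ⟨m, hm⟩ := ENat.ne_top_iff_exists.mp h2
      rw [← hm, tsum_eq_sum (s := Finset.range m)]
      · rw [Finset.sum_congr rfl (g := fun _ => (1 : ℝ≥0∞))]
        · simp
        · intro i hi
          rw [if_pos (by exact_mod_cast Finset.mem_range.mp hi)]
      · intro i hi
        rw [if_neg (by simpa using hi)]
  simp only [h]
  rw [lintegral_tsum fun n => (measurable_const.indicator (hA n)).aemeasurable]
  simp [hA]

/-- The sequences for which the sums of `z` over the outcomes number `j, …, k - 1` stay below `h`
for all `k ≤ n`. -/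
def noSumHit (z : X → ℝ) (h : ℝ) (j n : ℕ) : Set (ℕ → X) :=
  {x | ∀ k, j < k → k ≤ n → ∑ i ∈ Finset.Ico j k, z (x i) < h}

theorem dependsOn_noSumHit (z : X → ℝ) (c : ℝ) (j n : ℕ) :
    DependsOn (· ∈ noSumHit z c j n) (Set.Iio n) := by
  intro x y h
  refine forall_congr fun k => forall_congr fun _ => propext (forall_congr' fun hk => ?_)
  rw [Finset.sum_congr rfl fun i hi => by
    rw [h i (lt_of_lt_of_le (Finset.mem_Ico.mp hi).2 hk)]]

open Classical in
-- Before its last step the stopped walk is still at most `h` (here `0 ≤ h` covers the empty sum),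
-- and one step adds at most `B`. The first conjunct is what carries the induction.
theorem stopped_sum_le (z : X → ℝ) {h B : ℝ} (hh : 0 ≤ h) (hB : 0 ≤ B) (hz : ∀ a, z a ≤ B)
    (j n : ℕ) (hn : j ≤ n) (x : ℕ → X) :
    (x ∈ noSumHit z h j n → ∑ i ∈ Finset.Ico j n, (if x ∈ noSumHit z h j i then z (x i) else 0)
      = ∑ i ∈ Finset.Ico j n, z (x i)) ∧
    ∑ i ∈ Finset.Ico j n, (if x ∈ noSumHit z h j i then z (x i) else 0) ≤ h + B := by
  induction n, hn using Nat.le_induction with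
  | base => simp; positivity
  | succ n hn ih =>
    have hmono : x ∈ noSumHit z h j (n + 1) → x ∈ noSumHit z h j n :=
      fun hx k h1 h2 => hx k h1 (by omega)
    rw [Finset.sum_Ico_succ_top hn, Finset.sum_Ico_succ_top hn]
    refine ⟨fun hx => ?_, ?_⟩
    · rw [if_pos (hmono hx), ih.1 (hmono hx)]
    · by_cases hx : x ∈ noSumHit z h j n
      · rw [if_pos hx, ih.1 hx]
        have : ∑ i ∈ Finset.Ico j n, z (x i) ≤ h := by
          rcases hn.eq_or_lt with rfl | h1
          · simpa using hh
          · exact (hx n h1 le_rfl).le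
        linarith [hz (x n)]
      · rw [if_neg hx, add_zero]
        exact ih.2

variable [MeasurableSpace X] [MeasurableSingletonClass X] [Fintype X]

theorem measurableSet_noAlarm (lam : X → ℝ) (c : ℝ) (n : ℕ) : MeasurableSet (noAlarm lam c n) :=
  measurableSet_of_dependsOn (dependsOn_noAlarm lam c n)

/-- Only the tests started at some `j < n` can fire within the first `n` outcomes, and Ville's
inequality bounds each of them by `1 / c`. -/
theorem measureReal_compl_noAlarm_le (P : ℕ → PMF X) (lam : X → ℝ) {c : ℝ} (hc : 0 < c)
    (n : ℕ) (hlam : ∀ a, 0 ≤ lam a) (hP : ∀ i, ∑ a, (P i a).toReal * lam a ≤ 1) :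
    (seqLaw P).real (noAlarm lam c n)ᶜ ≤ n / c := by
  have hsub : (noAlarm lam c n)ᶜ ⊆ ⋃ j ∈ Finset.range n, (noHit lam c j n)ᶜ := by
    intro x hx
    simp only [noAlarm, Set.mem_compl_iff, Set.mem_ofPred_eq, not_forall] at hx
    obtain ⟨j, hj⟩ := hx
    simp only [Set.mem_iUnion]
    refine ⟨j, ?_, hj⟩
    by_contra h
    refine hj fun k h1 h2 => ?_
    simp only [Finset.mem_range] at h
    omega
  calc (seqLaw P).real (noAlarm lam c n)ᶜ
      ≤ (seqLaw P).real (⋃ j ∈ Finset.range n, (noHit lam c j n)ᶜ) :=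
        measureReal_mono hsub (measure_ne_top _ _)
    _ ≤ ∑ j ∈ Finset.range n, (seqLaw P).real (noHit lam c j n)ᶜ :=
        measureReal_biUnion_finset_le _ _
    _ ≤ ∑ j ∈ Finset.range n, 1 / c := Finset.sum_le_sum fun j hj =>
        measureReal_compl_noHit_le P lam hc j n (Finset.mem_range.mp hj).le hlam fun i _ => hP i
    _ = n / c := by simp [div_eq_mul_inv]

/-- The mean false alarm time grows at least linearly in the likelihood ratio threshold. -/
theorem le_tsum_measure_noAlarm (P : ℕ → PMF X) (lam : X → ℝ) {c : ℝ} (hc : 0 < c)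
    (hlam : ∀ a, 0 ≤ lam a) (hP : ∀ i, ∑ a, (P i a).toReal * lam a ≤ 1) :
    ENNReal.ofReal (c / 4) ≤ ∑' n, seqLaw P (noAlarm lam c n) := by
  -- Up to the horizon `c / 2` the union bound leaves probability at least 1/2 for no alarm; more
  -- than `c / 2` terms, each at least 1/2, give `c / 4`.
  set n := ⌊c / 2⌋₊
  have hn1 : (n : ℝ) ≤ c / 2 := Nat.floor_le (by positivity)
  have hn2 : c / 2 < n + 1 := Nat.lt_floor_add_one _
  have h1 : 1 / 2 ≤ (seqLaw P).real (noAlarm lam c n) := by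
    have h2 := measureReal_compl_noAlarm_le P lam hc n hlam hP
    rw [probReal_compl_eq_one_sub (measurableSet_noAlarm lam c n)] at h2
    have : n / c ≤ 1 / 2 := by
      rw [div_le_div_iff₀ hc two_pos]
      linarith
    linarith
  calc ENNReal.ofReal (c / 4) ≤ ENNReal.ofReal ((n + 1) * (seqLaw P).real (noAlarm lam c n)) := by
        apply ENNReal.ofReal_le_ofReal
        nlinarith
    _ = ∑ i ∈ Finset.range (n + 1), seqLaw P (noAlarm lam c n) := by
        rw [ENNReal.ofReal_mul (by positivity), ofReal_measureReal]
        simp [ENNReal.ofReal_add]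
    _ ≤ ∑ i ∈ Finset.range (n + 1), seqLaw P (noAlarm lam c i) :=
        Finset.sum_le_sum fun i hi => measure_mono
          (noAlarm_anti lam c (Nat.lt_succ_iff.mp (Finset.mem_range.mp hi)))
    _ ≤ _ := ENNReal.sum_le_tsum _

theorem measureReal_inter_run (P : ℕ → PMF X) {A : Set (ℕ → X)} {n : ℕ}
    (hA : DependsOn (· ∈ A) (Set.Iio n)) (a : X) {δ : ℝ} (hP : ∀ i, (P i a).toReal = δ) (k : ℕ) :
    (seqLaw P).real (A ∩ {x | ∀ i ∈ Finset.Ico n (n + k), x i = a}) =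
      (seqLaw P).real A * δ ^ k := by
  classical
  induction k with
  | zero => simp
  | succ k ih =>
    set B := A ∩ {x | ∀ i ∈ Finset.Ico n (n + k), x i = a} with hB
    have hBdep : DependsOn (· ∈ B) (Set.Iio (n + k)) := by
      intro x y h
      have h1 : (x ∈ A) = (y ∈ A) := hA fun i hi =>
        h i (Set.mem_Iio.mpr ((Set.mem_Iio.mp hi).trans_le (by omega)))
      simp only [hB, Set.mem_inter_iff, h1, Set.mem_ofPred_eq, eq_iff_iff]
      refine and_congr_right fun _ => forall₂_congr fun i hi => ?_
      rw [h i (Finset.mem_Ico.mp hi).2]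
    have hBm := measurableSet_of_dependsOn hBdep
    have hset : A ∩ {x | ∀ i ∈ Finset.Ico n (n + (k + 1)), x i = a} =
        B ∩ {x | x (n + k) = a} := by
      ext x
      simp only [hB, Set.mem_inter_iff, Set.mem_ofPred_eq, Finset.mem_Ico, and_assoc]
      refine and_congr_right fun _ => ⟨fun h => ⟨fun i hi => h i ⟨hi.1, by omega⟩,
        h _ ⟨by omega, by omega⟩⟩, fun h i hi => ?_⟩
      rcases Nat.lt_or_ge i (n + k) with h2 | h2
      · exact h.1 i ⟨hi.1, h2⟩
      · rw [show i = n + k by omega]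
        exact h.2
    have h1 := integral_mul_of_dependsOn P
      (dependsOn_indicator hBdep (f := fun _ => (1 : ℝ)) (fun _ _ _ => rfl))
      (fun b => if b = a then 1 else 0)
    have h2 : ∀ x : ℕ → X, B.indicator (fun _ => (1 : ℝ)) x * (if x (n + k) = a then 1 else 0) =
        (B ∩ {x | x (n + k) = a}).indicator 1 x := by
      intro x
      by_cases hx : x ∈ B <;> by_cases hy : x (n + k) = a <;> simp [hx, hy]
    have hm : MeasurableSet (B ∩ {x : ℕ → X | x (n + k) = a}) :=
      hBm.inter (measurableSet_eq_fun (measurable_pi_apply (n + k)) measurable_const)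
    simp only [h2] at h1
    rw [integral_indicator_one hm, integral_indicator_const _ hBm, smul_eq_mul, mul_one] at h1
    rw [hset, h1, ih]
    simp [hP, pow_succ, mul_assoc]

/-- The mean false alarm time is finite. -/
theorem tsum_measure_noAlarm_lt_top (P : ℕ → PMF X) (lam : X → ℝ) (c : ℝ) (a : X)
    (ha : 1 < lam a) {δ : ℝ} (hδ : 0 < δ) (hP : ∀ i, (P i a).toReal = δ) :
    ∑' n, seqLaw P (noAlarm lam c n) < ⊤ := by
  obtain ⟨k, hk⟩ := pow_unbounded_of_one_lt c ha
  -- A run of `k + 1` outcomes `a` forces an alarm. The extra outcome keeps the run nonempty when `k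
  -- = 0`.
  have hk1 : c ≤ lam a ^ (k + 1) := hk.le.trans (pow_le_pow_right₀ ha.le k.le_succ)
  set u : ℕ → ℝ := fun n => (seqLaw P).real (noAlarm lam c n)
  -- Given no alarm up to `n`, the forcing run follows with probability `δ ^ (k + 1)`, so survival
  -- decays geometrically over windows of length `k + 1`.
  have hstep : ∀ n, δ ^ (k + 1) * u n ≤ u n - u (n + (k + 1)) := by
    intro n
    have hm : MeasurableSet (noAlarm lam c n ∩
        {x | ∀ i ∈ Finset.Ico n (n + (k + 1)), x i = a}) := by
      apply measurableSet_of_dependsOn (n := n + (k + 1))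
      intro x y h
      have h1 : (x ∈ noAlarm lam c n) = (y ∈ noAlarm lam c n) :=
        dependsOn_noAlarm lam c n fun i hi =>
          h i (Set.mem_Iio.mpr ((Set.mem_Iio.mp hi).trans_le (by omega)))
      simp only [Set.mem_inter_iff, h1, Set.mem_ofPred_eq, eq_iff_iff]
      refine and_congr_right fun _ => forall₂_congr fun i hi => ?_
      rw [h i (Finset.mem_Ico.mp hi).2]
    have hsub : noAlarm lam c (n + (k + 1)) ⊆ noAlarm lam c n \ (noAlarm lam c n ∩
        {x | ∀ i ∈ Finset.Ico n (n + (k + 1)), x i = a}) := by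
      intro x hx
      refine ⟨noAlarm_anti lam c (by omega) hx, fun hx2 => ?_⟩
      have h1 := hx n (n + (k + 1)) (by omega) le_rfl
      rw [Finset.prod_congr rfl fun i hi => by rw [hx2.2 i hi], Finset.prod_const,
        Nat.card_Ico, Nat.add_sub_cancel_left] at h1
      linarith
    have h2 := measureReal_mono (μ := seqLaw P) hsub
    rw [measureReal_sdiff Set.inter_subset_left hm, measureReal_inter_run P
      (dependsOn_noAlarm lam c n) a hP] at h2
    simp only [u]
    linarith
  have hu1 : ∀ n, u n ≤ 1 := fun n => measureReal_le_one
  have hu0 : ∀ n, 0 ≤ u n := fun n => measureReal_nonneg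
  -- Summing `hstep` telescopes: the difference of the two shifted sums is at most the sum of the
  -- first `k + 1` terms, each at most 1.
  have hbound : ∀ N, ∑ n ∈ Finset.range N, u n ≤ (k + 1) / δ ^ (k + 1) := by
    intro N
    rw [le_div_iff₀ (by positivity), mul_comm]
    have h1 : δ ^ (k + 1) * ∑ n ∈ Finset.range N, u n ≤
        ∑ n ∈ Finset.range N, u n - ∑ n ∈ Finset.range N, u (n + (k + 1)) := by
      rw [Finset.mul_sum, ← Finset.sum_sub_distrib]
      exact Finset.sum_le_sum fun n _ => hstep n
    have h2 : ∑ n ∈ Finset.range N, u n ≤ ∑ n ∈ Finset.range ((k + 1) + N), u n :=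
      Finset.sum_le_sum_of_subset_of_nonneg (Finset.range_mono (by omega)) fun n _ _ => hu0 n
    rw [Finset.sum_range_add] at h2
    have h3 : ∑ n ∈ Finset.range (k + 1), u n ≤ k + 1 := by
      refine (Finset.sum_le_sum fun n _ => hu1 n).trans ?_
      simp
    have h4 : ∑ n ∈ Finset.range N, u (k + 1 + n) = ∑ n ∈ Finset.range N, u (n + (k + 1)) :=
      Finset.sum_congr rfl fun n _ => by rw [add_comm]
    linarith
  refine lt_of_le_of_lt (ENNReal.tsum_le_of_sum_range_le
    (c := ENNReal.ofReal ((k + 1) / δ ^ (k + 1)))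
    fun N => ?_) ENNReal.ofReal_lt_top
  rw [Finset.sum_congr rfl fun n _ => (ofReal_measureReal (μ := seqLaw P)
    (s := noAlarm lam c n)).symm, ← ENNReal.ofReal_sum_of_nonneg fun n _ => hu0 n]
  exact ENNReal.ofReal_le_ofReal (hbound N)

/-- Wald's identity, as a bound on the mean first passage time over the level `h` of a random
walk with drift `I`, restricted to an event of its past. -/
theorem sum_measureReal_noSumHit_le (P : ℕ → PMF X) (z : X → ℝ) {h B I : ℝ} (hh : 0 ≤ h)
    (hB : 0 ≤ B) (hz : ∀ a, z a ≤ B) {R : Set (ℕ → X)} {j : ℕ}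
    (hR : DependsOn (· ∈ R) (Set.Iio j)) (hI : ∀ i, j ≤ i → ∑ a, (P i a).toReal * z a = I)
    (n : ℕ) (hn : j ≤ n) :
    I * ∑ i ∈ Finset.Ico j n, (seqLaw P).real (R ∩ noSumHit z h j i) ≤
      (h + B) * (seqLaw P).real R := by
  classical
  have hdep : ∀ i, j ≤ i → DependsOn (· ∈ R ∩ noSumHit z h j i) (Set.Iio i) := by
    intro i hi x y hxy
    have h1 : (x ∈ R) = (y ∈ R) := hR fun k hk => hxy k (lt_of_lt_of_le hk hi)
    have h2 : (x ∈ noSumHit z h j i) = (y ∈ noSumHit z h j i) := dependsOn_noSumHit z h j i hxy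
    simp only [Set.mem_inter_iff, h1, h2]
  -- Whether step `i` is still taken is decided by the first `i` outcomes, hence independently of
  -- outcome `i`; each `F i` has mean `I` times the probability of still walking.
  let F : ℕ → (ℕ → X) → ℝ := fun i x => (R ∩ noSumHit z h j i).indicator 1 x * z (x i)
  have hF : ∀ i, j ≤ i → ∫ x, F i x ∂(seqLaw P) =
      (seqLaw P).real (R ∩ noSumHit z h j i) * I := by
    intro i hi
    rw [integral_mul_of_dependsOn P
      (dependsOn_indicator (hdep i hi) (f := 1) (fun _ _ _ => rfl)) z, hI i hi,
      integral_indicator_one (measurableSet_of_dependsOn (hdep i hi))]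
  have hFint : ∀ i ∈ Finset.Ico j n, Integrable (F i) (seqLaw P) := by
    intro i hi
    refine integrable_of_dependsOn P (k := i + 1) (DependsOn.comp₂
      ((dependsOn_indicator (hdep i (Finset.mem_Ico.mp hi).1) (f := 1)
        (fun _ _ _ => rfl)).mono (Set.Iio_subset_Iio i.le_succ)) ?_ _)
    intro x y hxy
    simp only [hxy i (Set.mem_Iio.mpr i.lt_succ_self)]
  have hRm := measurableSet_of_dependsOn hR
  have hle : ∫ x, ∑ i ∈ Finset.Ico j n, F i x ∂(seqLaw P) ≤
      ∫ x, R.indicator (fun _ => h + B) x ∂(seqLaw P) := by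
    refine integral_mono (integrable_finsetSum _ hFint)
      ((integrable_const _).indicator hRm) fun x => ?_
    by_cases hx : x ∈ R
    · rw [Set.indicator_of_mem hx]
      refine le_trans (le_of_eq ?_) (stopped_sum_le z hh hB hz j n hn x).2
      refine Finset.sum_congr rfl fun i _ => ?_
      by_cases hy : x ∈ noSumHit z h j i <;> simp [F, hx, hy]
    · simp [F, hx]
  rw [integral_finsetSum _ hFint, Finset.sum_congr rfl fun i hi => hF i (Finset.mem_Ico.mp hi).1,
    integral_indicator_const _ hRm, ← Finset.sum_mul, smul_eq_mul] at hle
  linarith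

end Alarm

/-! ### Outcome distributions as real numbers. -/

section Measurement

variable {n X : Type} [Fintype n] [DecidableEq n] [Fintype X]

/-- The probability `tr[M_x τ]` as a real number. -/
noncomputable def realProb (M : PVM n X) (τ : DensityMatrix n) (x : X) : ℝ :=
  (M.proj x * τ.val).trace.re

theorem outcomeProb_eq_ofReal (M : PVM n X) (τ : DensityMatrix n) (x : X) :
    outcomeProb M τ x = ENNReal.ofReal (realProb M τ x) := rfl

theorem trace_proj_mul (M : PVM n X) (A : Matrix n n ℂ) (x : X) :
    (M.proj x * A).trace = (M.proj x * A * (M.proj x)ᴴ).trace := by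
  rw [Matrix.trace_mul_comm (M.proj x * A), ← Matrix.mul_assoc,
    show (M.proj x)ᴴ = M.proj x from (M.isStarProjection x).isSelfAdjoint,
    (M.isStarProjection x).isIdempotentElem]

theorem realProb_nonneg (M : PVM n X) (τ : DensityMatrix n) (x : X) : 0 ≤ realProb M τ x := by
  rw [realProb, trace_proj_mul]
  have := (τ.posSemidef.mul_mul_conjTranspose_same (M.proj x)).trace_nonneg
  exact (Complex.le_def.mp this).1

theorem sum_realProb (M : PVM n X) (τ : DensityMatrix n) : ∑ x, realProb M τ x = 1 := by
  simp only [realProb]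
  rw [← Complex.re_sum, ← Matrix.trace_sum, ← Finset.sum_mul, M.sum_eq_one, Matrix.one_mul,
    τ.trace_eq_one, Complex.one_re]

theorem toReal_outcomePMF (M : PVM n X) (τ : DensityMatrix n) (x : X) :
    (outcomePMF M τ x).toReal = realProb M τ x :=
  ENNReal.toReal_ofReal (realProb_nonneg M τ x)

/-- Outcomes impossible on `ρ` are impossible on `σ`. -/
def OutcomesAC (M : PVM n X) (σ ρ : DensityMatrix n) : Prop :=
  ∀ x, realProb M ρ x = 0 → realProb M σ x = 0

/-- The relative entropy of the outcome distributions on `σ` and on `ρ`. -/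
noncomputable def measuredEntropy (M : PVM n X) (σ ρ : DensityMatrix n) : ℝ :=
  ∑ x, realProb M σ x * Real.log (realProb M σ x / realProb M ρ x)

end Measurement

theorem sum_ennrealLog {ι : Type*} (s : Finset ι) (f : ι → ℝ≥0∞) :
    ∑ i ∈ s, ENNReal.log (f i) = ENNReal.log (∏ i ∈ s, f i) := by
  classical
  induction s using Finset.induction_on with
  | empty => simp
  | insert a s ha ih => rw [Finset.sum_insert ha, Finset.prod_insert ha, ih, ENNReal.log_mul_add]

theorem coe_le_log_ofReal_iff (h y : ℝ) :
    (h : EReal) ≤ ENNReal.log (ENNReal.ofReal y) ↔ Real.exp h ≤ y := by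
  rw [ENNReal.log_ofReal]
  split_ifs with hy
  · simp only [le_bot_iff, EReal.coe_ne_bot, false_iff, not_le]
    exact lt_of_le_of_lt hy (Real.exp_pos h)
  · rw [EReal.coe_le_coe_iff, Real.le_log_iff_exp_le (not_le.mp hy)]

/-! ### Stopping times as events of likelihood products, and the false alarm time. -/

section Blocks

variable {d l m : ℕ} (M : PVM (Fin l → Fin d) (Fin m)) (ρ σ : DensityMatrix (Fin d))

/-- The state `ρ^{⊗ l}`. -/
abbrev iidState (l : ℕ) (ρ : DensityMatrix (Fin d)) : DensityMatrix (Fin l → Fin d) :=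
  tensorState fun _ : Fin l => ρ

/-- The likelihood ratio of a block outcome. -/
noncomputable def likelihoodRatio (x : Fin m) : ℝ :=
  realProb M (iidState l σ) x / realProb M (iidState l ρ) x

theorem likelihoodRatio_nonneg (x : Fin m) : 0 ≤ likelihoodRatio M ρ σ x :=
  div_nonneg (realProb_nonneg _ _ _) (realProb_nonneg _ _ _)

theorem outcomeLaw_eq_seqLaw (ν : ℕ∞) :
    outcomeLaw M ρ σ ν = seqLaw fun k => outcomePMF M (blockState ρ σ l ν k) := rfl

theorem blockState_of_le {ν : ℕ∞} {k : ℕ} (h : ((k * l + l : ℕ) : ℕ∞) ≤ ν) :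
    blockState ρ σ l ν k = iidState l ρ := by
  unfold blockState iidState
  congr 1
  funext r
  rw [copyState, if_pos]
  refine le_trans ?_ h
  exact_mod_cast (by have := r.2; omega : k * l + r + 1 ≤ k * l + l)

theorem blockState_of_ge {ν k : ℕ} (h : ν ≤ k * l) :
    blockState ρ σ l (ν : ℕ∞) k = iidState l σ := by
  unfold blockState iidState
  congr 1
  funext r
  rw [copyState, if_neg]
  rw [Nat.cast_le]
  omega

variable {M ρ σ} (hac : OutcomesAC M (iidState l σ) (iidState l ρ))

include hac

/-- In product form the value `⊥` of the logarithm becomes a harmless factor 0. `hac` rules out a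
positive number over zero, and `0 / 0` is 0 both in `ℝ≥0∞` and in `ℝ`, so the real ratio is
faithful. -/
theorem le_sum_logLikelihoodRatio_iff (h : ℝ) (s : Finset ℕ) (x : ℕ → Fin m) :
    (h : EReal) ≤ ∑ i ∈ s, logLikelihoodRatio M ρ σ (x i) ↔
      Real.exp h ≤ ∏ i ∈ s, likelihoodRatio M ρ σ (x i) := by
  have h1 : ∀ a, logLikelihoodRatio M ρ σ a =
      ENNReal.log (ENNReal.ofReal (likelihoodRatio M ρ σ a)) := by
    intro a
    unfold logLikelihoodRatio likelihoodRatio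
    rw [outcomeProb_eq_ofReal, outcomeProb_eq_ofReal]
    rcases (realProb_nonneg M (iidState l ρ) a).eq_or_lt' with h0 | h0
    · rw [hac a h0, h0]; simp
    · rw [ENNReal.ofReal_div_of_pos h0]
  simp only [h1]
  rw [sum_ennrealLog, ← ENNReal.ofReal_prod_of_nonneg fun i _ => likelihoodRatio_nonneg M ρ σ _,
    coe_le_log_ofReal_iff]

theorem lt_oneSidedTime_iff (h : ℝ) (j k : ℕ) (x : ℕ → Fin m) :
    (k : ℕ∞) < oneSidedTime M ρ σ h j x ↔
      x ∈ noHit (likelihoodRatio M ρ σ) (Real.exp h) j k := by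
  rw [← ENat.natCast_add_one_le_iff, oneSidedTime]
  simp only [le_iInf_iff, le_sum_logLikelihoodRatio_iff hac, noHit, Set.mem_ofPred_eq]
  refine forall_congr' fun i => ⟨fun h1 h2 h3 => ?_, fun h1 h2 => ?_⟩
  · by_contra h4
    have h5 := h1 ⟨h2, not_lt.mp h4⟩
    have : k + 1 ≤ i := by exact_mod_cast h5
    omega
  · by_contra h4
    have h5 : ¬ k + 1 ≤ i := fun h6 => h4 (by exact_mod_cast h6)
    exact absurd (h1 h2.1 (by omega)) (not_lt.mpr h2.2)

theorem lt_cusumTime_iff (h : ℝ) (k : ℕ) (x : ℕ → Fin m) :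
    (k : ℕ∞) < cusumTime M ρ σ h x ↔
      x ∈ noAlarm (likelihoodRatio M ρ σ) (Real.exp h) k := by
  rw [← ENat.natCast_add_one_le_iff, cusumTime, le_iInf_iff]
  simp only [ENat.natCast_add_one_le_iff, lt_oneSidedTime_iff hac]
  rfl

theorem meanFalseAlarmTime_eq (h : ℝ) :
    meanFalseAlarmTime M ρ σ h = (l : ℝ≥0∞) * ∑' k, seqLaw
      (fun _ => outcomePMF M (iidState l ρ))
      (noAlarm (likelihoodRatio M ρ σ) (Real.exp h) k) := by
  unfold meanFalseAlarmTime qusumTime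
  rw [lintegral_const_mul', lintegral_enat_eq_tsum _ _ _
    (fun k => measurableSet_noAlarm _ _ k) (fun k x => lt_cusumTime_iff hac h k x),
    outcomeLaw_eq_seqLaw]
  · simp only [blockState_of_le ρ σ (le_top : _ ≤ (⊤ : ℕ∞))]
  · exact ENNReal.natCast_ne_top l

theorem le_meanFalseAlarmTime (hl : 1 ≤ l) (h : ℝ) :
    ENNReal.ofReal (Real.exp h / 4) ≤ meanFalseAlarmTime M ρ σ h := by
  rw [meanFalseAlarmTime_eq hac]
  refine le_trans (le_tsum_measure_noAlarm _ _ (Real.exp_pos h)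
    (likelihoodRatio_nonneg M ρ σ) fun i => ?_) (le_mul_of_one_le_left (zero_le) ?_)
  -- The mean of the likelihood ratio under `ρ` is compared with the total mass of the outcome
  -- distribution on `σ`.
  · rw [← sum_realProb M (iidState l σ)]
    refine Finset.sum_le_sum fun a _ => ?_
    rw [toReal_outcomePMF, likelihoodRatio]
    rcases (realProb_nonneg M (iidState l ρ) a).eq_or_lt' with h0 | h0
    · rw [hac a h0, h0]; simp
    · rw [mul_div_cancel₀ _ h0.ne']
  · exact_mod_cast hl

/-- A positive divergence has a positive term, which yields an outcome with likelihood ratio above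
1. It has positive probability on `ρ`, since otherwise the ratio would be 0 by the convention for
division. Runs of this outcome end the test. -/
theorem meanFalseAlarmTime_lt_top
    (hpos : 0 < measuredEntropy M (iidState l σ) (iidState l ρ)) (h : ℝ) :
    meanFalseAlarmTime M ρ σ h < ⊤ := by
  obtain ⟨a, -, ha⟩ := Finset.exists_lt_of_sum_lt (s := Finset.univ) (f := fun _ : Fin m => (0 : ℝ))
    (by simpa [measuredEntropy] using hpos)
  have hlam : 1 < likelihoodRatio M ρ σ a := by
    rw [← Real.log_pos_iff (likelihoodRatio_nonneg M ρ σ a)]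
    exact pos_of_mul_pos_right ha (realProb_nonneg _ _ _)
  have hp : 0 < realProb M (iidState l ρ) a := by
    refine (realProb_nonneg _ _ _).lt_of_ne' fun h0 => ?_
    rw [likelihoodRatio, h0, div_zero] at hlam
    linarith
  rw [meanFalseAlarmTime_eq hac]
  exact ENNReal.mul_lt_top (ENNReal.natCast_lt_top l)
    (tsum_measure_noAlarm_lt_top _ _ _ a hlam hp fun i => toReal_outcomePMF _ _ _)

end Blocks

/-! ### The worst mean delay after the change. -/

section Delay

/-- The probability of an event of the first `k` outcomes depends on their distributions only. -/
theorem seqLaw_congr {X : Type*} [MeasurableSpace X] [MeasurableSingletonClass X] [Fintype X]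
    (P Q : ℕ → PMF X) {k : ℕ} (h : ∀ i < k, P i = Q i) {A : Set (ℕ → X)}
    (hA : DependsOn (· ∈ A) (Set.Iio k)) : seqLaw P A = seqLaw Q A := by
  obtain ⟨g, hg⟩ := dependsOn_iff_exists_comp.mp hA
  let S : Set (Finset.range k → X) := {z | g fun i => z ⟨i, Finset.mem_range.mpr i.2⟩}
  have hS : A = (Finset.range k).restrict ⁻¹' S := by
    ext x
    exact iff_of_eq (congrFun hg x)
  have hm : MeasurableSet S := S.to_countable.measurableSet
  have key : ∀ P : ℕ → PMF X, seqLaw P A =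
      Measure.pi (fun i : Finset.range k => (P i).toMeasure) S := by
    intro P
    rw [hS, ← Measure.infinitePi_map_restrict (fun i => (P i).toMeasure),
      Measure.map_apply (by fun_prop) hm]
    rfl
  rw [key, key]
  congr 2
  funext i
  rw [h i (Finset.mem_range.mp i.2)]

variable {d l m : ℕ} {M : PVM (Fin l → Fin d) (Fin m)} {ρ σ : DensityMatrix (Fin d)}

/-- Wald's bound needs finite increments. Outcomes with likelihood ratio 0, where `Real.log` takes
its default value, have probability zero after the change, so products and sums of logarithms define
the same events almost surely. -/
theorem sum_measureReal_noHit_le (hac : OutcomesAC M (iidState l σ) (iidState l ρ))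
    (hpos : 0 < measuredEntropy M (iidState l σ) (iidState l ρ))
    (P : ℕ → PMF (Fin m)) {j : ℕ} (hP : ∀ i, j ≤ i → P i = outcomePMF M (iidState l σ))
    {h B : ℝ} (hh : 0 ≤ h) (hB : 0 ≤ B) (hBz : ∀ a, Real.log (likelihoodRatio M ρ σ a) ≤ B)
    {R : Set (ℕ → Fin m)} (hR : DependsOn (· ∈ R) (Set.Iio j)) (n : ℕ) (hn : j ≤ n) :
    ∑ i ∈ Finset.Ico j n,
      (seqLaw P).real (R ∩ noHit (likelihoodRatio M ρ σ) (Real.exp h) j i) ≤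
      (h + B) / measuredEntropy M (iidState l σ) (iidState l ρ) * (seqLaw P).real R := by
  have hae : ∀ᵐ x ∂(seqLaw P), ∀ i, j ≤ i → 0 < likelihoodRatio M ρ σ (x i) := by
    rw [ae_all_iff]
    intro i
    by_cases hi : j ≤ i
    · have h1 : ∀ᵐ x ∂(seqLaw P), ∀ a, realProb M (iidState l σ) a = 0 → x i ≠ a := by
        rw [ae_all_iff]
        intro a
        by_cases ha : realProb M (iidState l σ) a = 0
        · have h2 : P i a = 0 := by
            rw [hP i hi]
            change outcomeProb _ _ _ = 0
            rw [outcomeProb_eq_ofReal, ha, ENNReal.ofReal_zero]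
          filter_upwards [ae_ne_of_apply_eq_zero P i a h2] with x hx _ using hx
        · simp [ha]
      filter_upwards [h1] with x hx _
      have hq : realProb M (iidState l σ) (x i) ≠ 0 := fun h => hx _ h rfl
      exact div_pos ((realProb_nonneg _ _ _).lt_of_ne' hq)
        ((realProb_nonneg _ _ _).lt_of_ne' fun h => hq (hac _ h))
    · simp [hi]
  have hcongr : ∀ i, (seqLaw P).real (R ∩ noHit (likelihoodRatio M ρ σ) (Real.exp h) j i) =
      (seqLaw P).real (R ∩ noSumHit (fun a => Real.log (likelihoodRatio M ρ σ a)) h j i) := by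
    intro i
    refine measureReal_congr ?_
    filter_upwards [hae] with x hx
    refine propext (and_congr_right fun _ => forall_congr' fun k => forall₂_congr fun _ _ => ?_)
    have h0 : ∀ i ∈ Finset.Ico j k, likelihoodRatio M ρ σ (x i) ≠ 0 :=
      fun i hi => (hx i (Finset.mem_Ico.mp hi).1).ne'
    rw [← Real.log_prod h0, Real.log_lt_iff_lt_exp
      (Finset.prod_pos fun i hi => hx i (Finset.mem_Ico.mp hi).1)]
  simp only [hcongr]
  have hw := sum_measureReal_noSumHit_le P (fun a => Real.log (likelihoodRatio M ρ σ a)) hh hB hBz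
    hR (I := measuredEntropy M (iidState l σ) (iidState l ρ)) (fun i hi => by
      simp only [hP i hi, toReal_outcomePMF]; rfl) n hn
  rw [div_mul_eq_mul_div, le_div_iff₀ hpos, mul_comm]
  exact hw

theorem dependsOn_recordEvent (l ν : ℕ) (y : Fin (ν / l) → Fin m) :
    DependsOn (· ∈ recordEvent l ν y) (Set.Iio (ν / l)) := by
  intro x z h
  exact forall_congr fun k => by rw [h k k.2]

/-- The alarm time is a multiple of `l`, so exceeding `ν` is decided by the completed blocks alone,
that is, by the record on which the delay is conditioned. -/
theorem lt_qusumTime_iff (hac : OutcomesAC M (iidState l σ) (iidState l ρ)) (hl : 1 ≤ l)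
    (h : ℝ) (ν : ℕ) (x : ℕ → Fin m) : (ν : ℝ≥0∞) < qusumTime M ρ σ h x ↔
      x ∈ noAlarm (likelihoodRatio M ρ σ) (Real.exp h) (ν / l) := by
  rw [← lt_cusumTime_iff hac, qusumTime]
  have e : (l : ℝ≥0∞) * (cusumTime M ρ σ h x : ℝ≥0∞) =
      ((l * cusumTime M ρ σ h x : ℕ∞) : ℝ≥0∞) := by push_cast; rfl
  have e2 : (ν : ℝ≥0∞) = ((ν : ℕ∞) : ℝ≥0∞) := by simp
  rw [e, e2, ENat.toENNReal_lt]
  rcases eq_or_ne (cusumTime M ρ σ h x) ⊤ with h1 | h1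
  · rw [h1, ENat.mul_top (by exact_mod_cast (by omega : l ≠ 0))]
    simp
  · obtain ⟨t, ht⟩ := ENat.ne_top_iff_exists.mp h1
    rw [← ht]
    norm_cast
    rw [Nat.div_lt_iff_lt_mul (by omega), mul_comm]

/-- CUSUM stops no later than any single one-sided test, and replacing `ν` by the end of the last
completed block only increases the difference. -/
theorem qusumTime_sub_le (h : ℝ) (ν j : ℕ) (x : ℕ → Fin m) :
    qusumTime M ρ σ h x - (ν : ℝ≥0∞) ≤
      (l : ℝ≥0∞) * ((oneSidedTime M ρ σ h j x - ((ν / l : ℕ) : ℕ∞) : ℕ∞) : ℝ≥0∞) := by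
  rw [ENat.toENNReal_sub, ENNReal.mul_sub fun _ _ => ENNReal.natCast_ne_top l]
  refine tsub_le_tsub (mul_le_mul_right (ENat.toENNReal_le.mpr (iInf_le _ j)) _) ?_
  rw [ENat.toENNReal_coe]
  exact_mod_cast Nat.mul_div_le ν l

/-- The law of block `j` is arbitrary, because the change may fall inside it. The test therefore
starts at `j + 1`; the skipped block is the summand 1 in the bound. -/
theorem setLIntegral_oneSidedTime_le (hac : OutcomesAC M (iidState l σ) (iidState l ρ))
    (hpos : 0 < measuredEntropy M (iidState l σ) (iidState l ρ))
    (P : ℕ → PMF (Fin m)) {j : ℕ} (hP : ∀ i, j + 1 ≤ i → P i = outcomePMF M (iidState l σ))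
    {h B : ℝ} (hh : 0 ≤ h) (hB : 0 ≤ B) (hBz : ∀ a, Real.log (likelihoodRatio M ρ σ a) ≤ B)
    {R : Set (ℕ → Fin m)} (hR : DependsOn (· ∈ R) (Set.Iio j)) :
    ∫⁻ x in R, ((oneSidedTime M ρ σ h (j + 1) x - (j : ℕ∞) : ℕ∞) : ℝ≥0∞) ∂(seqLaw P) ≤
      ENNReal.ofReal (1 + (h + B) / measuredEntropy M (iidState l σ) (iidState l ρ)) *
        seqLaw P R := by
  set I := measuredEntropy M (iidState l σ) (iidState l ρ)
  set A : ℕ → Set (ℕ → Fin m) := fun n =>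
    noHit (likelihoodRatio M ρ σ) (Real.exp h) (j + 1) (n + j)
  have hA : ∀ n, MeasurableSet (A n) := fun n =>
    measurableSet_of_dependsOn (dependsOn_noHit _ _ _ _)
  rw [lintegral_enat_eq_tsum _ _ A hA fun n x => by
    rw [lt_tsub_iff_right, ← Nat.cast_add, lt_oneSidedTime_iff hac]]
  have hR1 : DependsOn (· ∈ R) (Set.Iio (j + 1)) := hR.mono (Set.Iio_subset_Iio j.le_succ)
  have hconst : 0 ≤ 1 + (h + B) / I := by positivity
  have hμR : seqLaw P R = ENNReal.ofReal ((seqLaw P).real R) := by rw [ofReal_measureReal]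
  refine ENNReal.tsum_le_of_sum_range_le fun N => ?_
  have hreal : ∑ n ∈ Finset.range (N + 1), (seqLaw P).real (A n ∩ R) ≤
      (1 + (h + B) / I) * (seqLaw P).real R := by
    rw [Finset.sum_range_succ']
    have h1 := sum_measureReal_noHit_le hac hpos P hP hh hB hBz hR1 (j + 1 + N) (by omega)
    rw [Finset.sum_Ico_eq_sum_range, Nat.add_sub_cancel_left] at h1
    have h2 : ∀ n, A (n + 1) ∩ R =
        R ∩ noHit (likelihoodRatio M ρ σ) (Real.exp h) (j + 1) (j + 1 + n) := fun n => by
      rw [Set.inter_comm, show j + 1 + n = n + 1 + j by omega]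
    simp only [h2]
    have h3 : (seqLaw P).real (A 0 ∩ R) ≤ (seqLaw P).real R :=
      measureReal_mono Set.inter_subset_right
    linarith
  calc ∑ n ∈ Finset.range N, (seqLaw P).restrict R (A n)
      ≤ ∑ n ∈ Finset.range (N + 1), (seqLaw P).restrict R (A n) :=
        Finset.sum_le_sum_of_subset (Finset.range_mono N.le_succ)
    _ = ENNReal.ofReal (∑ n ∈ Finset.range (N + 1), (seqLaw P).real (A n ∩ R)) := by
        rw [ENNReal.ofReal_sum_of_nonneg fun _ _ => measureReal_nonneg]
        exact Finset.sum_congr rfl fun n _ => by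
          rw [Measure.restrict_apply (hA n), ofReal_measureReal]
    _ ≤ _ := by
        rw [hμR, ← ENNReal.ofReal_mul hconst]
        exact ENNReal.ofReal_le_ofReal hreal

/-- The worst mean delay exceeds that of a random walk with the post-change drift by at most the
length of a block. -/
theorem worstMeanDelay_le (hac : OutcomesAC M (iidState l σ) (iidState l ρ)) (hl : 1 ≤ l)
    (hpos : 0 < measuredEntropy M (iidState l σ) (iidState l ρ))
    {h B : ℝ} (hh : 0 ≤ h) (hB : 0 ≤ B)
    (hBz : ∀ a, Real.log (likelihoodRatio M ρ σ a) ≤ B) :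
    worstMeanDelay M ρ σ h ≤ ENNReal.ofReal
      (l * (1 + (h + B) / measuredEntropy M (iidState l σ) (iidState l ρ))) := by
  set I := measuredEntropy M (iidState l σ) (iidState l ρ)
  unfold worstMeanDelay
  refine iSup_le fun ν => iSup_le fun y => iSup_le fun hy => ?_
  set R := recordEvent l ν y
  have hR : DependsOn (· ∈ R) (Set.Iio (ν / l)) := dependsOn_recordEvent l ν y
  set P : ℕ → PMF (Fin m) := fun k => outcomePMF M (blockState ρ σ l ν k)
  have hlaw : outcomeLaw M ρ σ (ν : ℕ∞) = seqLaw P := rfl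
  have hdiv : (ν / l) * l ≤ ν := Nat.div_mul_le_self ν l
  have hdiv2 : ν < ((ν / l) + 1) * l := by
    rw [← Nat.div_lt_iff_lt_mul (by omega)]; exact Nat.lt_succ_self _
  have hP : ∀ i, (ν / l) + 1 ≤ i → P i = outcomePMF M (iidState l σ) := by
    intro i hi
    simp only [P]
    rw [blockState_of_ge ρ σ (hdiv2.le.trans (Nat.mul_le_mul_right l hi))]
  -- The recorded blocks precede the change, so the record has the same probability under `P_ν` and
  -- `P_∞`.
  have hμR : seqLaw P R ≠ 0 := by
    rw [outcomeLaw_eq_seqLaw, seqLaw_congr _ P ?_ hR] at hy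
    · exact hy.ne'
    · intro i hi
      simp only [P]
      rw [blockState_of_le ρ σ le_top, blockState_of_le ρ σ]
      have : (i + 1) * l ≤ (ν / l) * l := Nat.mul_le_mul_right l hi
      exact_mod_cast (by linarith : i * l + l ≤ ν)
  rw [hlaw]
  have hset : {x | (ν : ℝ≥0∞) < qusumTime M ρ σ h x} ∩ R =
      noAlarm (likelihoodRatio M ρ σ) (Real.exp h) (ν / l) ∩ R := by
    ext x
    exact and_congr_left fun _ => lt_qusumTime_iff hac hl h ν x
  rw [hset]
  by_cases hne : (noAlarm (likelihoodRatio M ρ σ) (Real.exp h) (ν / l) ∩ R).Nonempty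
  · obtain ⟨x₀, hx₀, hx₀R⟩ := hne
    -- The record determines whether an alarm has been raised, so the conditioning event is either
    -- all of `R` or empty. In the empty case `cond` is the zero measure and contributes no delay.
    have hsub : noAlarm (likelihoodRatio M ρ σ) (Real.exp h) (ν / l) ∩ R = R := by
      refine Set.inter_eq_right.mpr fun x hx => ?_
      have h1 : (x ∈ noAlarm (likelihoodRatio M ρ σ) (Real.exp h) (ν / l)) =
          (x₀ ∈ noAlarm (likelihoodRatio M ρ σ) (Real.exp h) (ν / l)) :=
        dependsOn_noAlarm _ _ (ν / l) fun i hi =>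
          (hx ⟨i, hi⟩).trans (hx₀R ⟨i, hi⟩).symm
      rw [h1]
      exact hx₀
    rw [hsub, ProbabilityTheory.cond, lintegral_smul_measure, smul_eq_mul]
    calc (seqLaw P R)⁻¹ * ∫⁻ x in R, (qusumTime M ρ σ h x - (ν : ℝ≥0∞)) ∂(seqLaw P)
        ≤ (seqLaw P R)⁻¹ * ∫⁻ x in R, (l : ℝ≥0∞) *
            ((oneSidedTime M ρ σ h ((ν / l) + 1) x - ((ν / l : ℕ) : ℕ∞) : ℕ∞) : ℝ≥0∞) ∂(seqLaw P) := by
          gcongr with x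
          exact qusumTime_sub_le h ν ((ν / l) + 1) x
      _ ≤ (seqLaw P R)⁻¹ * ((l : ℝ≥0∞) * (ENNReal.ofReal (1 + (h + B) / I) * seqLaw P R)) := by
          rw [lintegral_const_mul' _ _ (ENNReal.natCast_ne_top l)]
          gcongr
          exact setLIntegral_oneSidedTime_le hac hpos P hP hh hB hBz hR
      _ = (l : ℝ≥0∞) * ENNReal.ofReal (1 + (h + B) / I) := by
          rw [← mul_assoc (l : ℝ≥0∞), mul_comm _ (seqLaw P R), ← mul_assoc,
            ENNReal.inv_mul_cancel hμR (measure_ne_top _ _), one_mul]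
      _ = _ := by
          rw [ENNReal.ofReal_mul (by positivity), ENNReal.ofReal_natCast]
  · rw [Set.not_nonempty_iff_eq_empty.mp hne, cond_empty, lintegral_zero_measure]
    exact zero_le

end Delay

/-! ### From drift to the asymptotic rate. -/

section Rate

variable {d l m : ℕ} {M : PVM (Fin l → Fin d) (Fin m)} {ρ σ : DensityMatrix (Fin d)}

/-- The alphabet is finite, so one `B` bounds all increments independently of `h`. The drift bound
then turns the cost per block into the rate `D` per copy, and the constant is `l + B / D`. -/
theorem exists_worstMeanDelay_le (hac : OutcomesAC M (iidState l σ) (iidState l ρ)) (hl : 1 ≤ l)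
    {D : ℝ} (hD : 0 < D) (hI : l * D ≤ measuredEntropy M (iidState l σ) (iidState l ρ)) :
    ∃ K : ℝ, ∀ h : ℝ, 0 ≤ h → (worstMeanDelay M ρ σ h : EReal) ≤ ((h / D + K : ℝ) : EReal) := by
  set I := measuredEntropy M (iidState l σ) (iidState l ρ)
  set B := ∑ a, |Real.log (likelihoodRatio M ρ σ a)|
  have hl0 : (0 : ℝ) < l := by exact_mod_cast hl
  have hpos : 0 < I := lt_of_lt_of_le (by positivity) hI
  have hB : 0 ≤ B := Finset.sum_nonneg fun _ _ => abs_nonneg _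
  have hBz : ∀ a, Real.log (likelihoodRatio M ρ σ a) ≤ B := fun a =>
    (le_abs_self _).trans (Finset.single_le_sum (f := fun a =>
      |Real.log (likelihoodRatio M ρ σ a)|) (fun _ _ => abs_nonneg _) (Finset.mem_univ a))
  refine ⟨l + B / D, fun h hh => ?_⟩
  have h1 := EReal.coe_ennreal_le_coe_ennreal_iff.mpr
    (worstMeanDelay_le hac hl hpos hh hB hBz)
  refine h1.trans ?_
  rw [EReal.coe_ennreal_ofReal, EReal.coe_le_coe_iff]
  refine max_le ?_ (by positivity)
  have h2 : l * ((h + B) / I) ≤ (h + B) / D := by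
    rw [mul_div_assoc', div_le_div_iff₀ hpos hD]
    nlinarith [mul_le_mul_of_nonneg_left hI (add_nonneg hh hB)]
  calc l * (1 + (h + B) / I) = l + l * ((h + B) / I) := by ring
    _ ≤ l + (h + B) / D := by gcongr
    _ = h / D + (l + B / D) := by ring

/-- The classical performance of QUSUM with a block measurement that achieves the rate `D`. -/
theorem exists_constants (hac : OutcomesAC M (iidState l σ) (iidState l ρ)) (hl : 1 ≤ l)
    {D : ℝ} (hD : 0 < D) (hI : l * D ≤ measuredEntropy M (iidState l σ) (iidState l ρ)) :
    ∃ C T₀ : ℝ,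
      (∀ h : ℝ, 0 ≤ h → meanFalseAlarmTime M ρ σ h < ⊤ ∧
        (worstMeanDelay M ρ σ h : EReal) ≤
          ((Real.log (meanFalseAlarmTime M ρ σ h).toReal / D + C : ℝ) : EReal)) ∧
      (∀ T : ℝ, T₀ ≤ T → ∃ h : ℝ, 0 ≤ h ∧
        ENNReal.ofReal T ≤ meanFalseAlarmTime M ρ σ h ∧
        (worstMeanDelay M ρ σ h : EReal) ≤ ((Real.log T / D + C : ℝ) : EReal)) := by
  obtain ⟨K, hK⟩ := exists_worstMeanDelay_le hac hl hD hI
  have hl0 : (0 : ℝ) < l := by exact_mod_cast hl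
  have hpos : 0 < measuredEntropy M (iidState l σ) (iidState l ρ) :=
    lt_of_lt_of_le (by positivity) hI
  -- `log 4` compensates the factor 1/4 in the false alarm bound. For a prescribed `T` the threshold
  -- `log (4 * T)` turns that bound into exactly `T`, and it is nonnegative because `T ≥ 1`.
  refine ⟨Real.log 4 / D + K, 1, fun h hh => ?_, fun T hT => ?_⟩
  · have hfin := meanFalseAlarmTime_lt_top hac hpos h
    refine ⟨hfin, (hK h hh).trans ?_⟩
    have h1 := ENNReal.toReal_mono hfin.ne (le_meanFalseAlarmTime hac hl h)
    rw [ENNReal.toReal_ofReal (by positivity)] at h1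
    have h2 := Real.log_le_log (by positivity) h1
    rw [Real.log_div (Real.exp_pos h).ne' (by norm_num), Real.log_exp] at h2
    rw [EReal.coe_le_coe_iff]
    have h3 : h / D ≤ (Real.log (meanFalseAlarmTime M ρ σ h).toReal + Real.log 4) / D := by
      gcongr
      linarith
    rw [add_div] at h3
    linarith
  · have hT0 : 0 < T := by linarith
    refine ⟨Real.log (4 * T), Real.log_nonneg (by linarith), ?_, (hK _
      (Real.log_nonneg (by linarith))).trans ?_⟩
    · have h1 := le_meanFalseAlarmTime hac hl (Real.log (4 * T))
      rw [Real.exp_log (by positivity)] at h1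
      rwa [mul_div_cancel_left₀ _ (by norm_num)] at h1
    · rw [EReal.coe_le_coe_iff, Real.log_mul (by norm_num) hT0.ne', add_div]
      linarith

end Rate

/-! ### Tensor products of matrices over a finite index set. -/

section PiMatrix

variable {ι N : Type} [Fintype ι] [Fintype N] [DecidableEq ι]

/-- The tensor product of a family of matrices. -/
def piMatrix (A : ι → Matrix N N ℂ) : Matrix (ι → N) (ι → N) ℂ :=
  fun i j => ∏ k, A k (i k) (j k)

theorem piMatrix_mul (A B : ι → Matrix N N ℂ) :
    piMatrix A * piMatrix B = piMatrix fun k => A k * B k := by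
  ext i j
  simp only [piMatrix, Matrix.mul_apply, ← Finset.prod_mul_distrib]
  rw [Finset.prod_univ_sum, Fintype.piFinset_univ]

omit [Fintype N] [DecidableEq ι] in
theorem piMatrix_conjTranspose (A : ι → Matrix N N ℂ) :
    (piMatrix A)ᴴ = piMatrix fun k => (A k)ᴴ := by
  ext i j
  simp [piMatrix, Matrix.conjTranspose_apply]

theorem trace_piMatrix (A : ι → Matrix N N ℂ) : (piMatrix A).trace = ∏ k, (A k).trace := by
  have h := Finset.prod_univ_sum (fun _ : ι => (Finset.univ : Finset N)) (fun k i => A k i i)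
  rw [Fintype.piFinset_univ] at h
  exact h.symm

omit [Fintype N] in
theorem sum_piMatrix {X : Type} [Fintype X] (A : X → Matrix N N ℂ) :
    ∑ x : ι → X, piMatrix (fun k => A (x k)) = piMatrix fun _ : ι => ∑ x, A x := by
  ext i j
  simp only [piMatrix, Matrix.sum_apply]
  rw [Finset.prod_univ_sum, Fintype.piFinset_univ]

omit [Fintype N] [DecidableEq ι] in
theorem piMatrix_diagonal [DecidableEq N] (f : ι → N → ℂ) :
    piMatrix (fun k => Matrix.diagonal (f k)) = Matrix.diagonal fun i => ∏ k, f k (i k) := by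
  ext i j
  simp only [piMatrix, Matrix.diagonal_apply]
  by_cases h : i = j
  · simp [h]
  · rw [if_neg h]
    obtain ⟨k, hk⟩ := Function.ne_iff.mp h
    exact Finset.prod_eq_zero (Finset.mem_univ k) (by rw [if_neg hk])

omit [Fintype N] [DecidableEq ι] in
theorem piMatrix_one [DecidableEq N] :
    piMatrix (fun _ : ι => (1 : Matrix N N ℂ)) = 1 := by
  have := piMatrix_diagonal (ι := ι) (fun (_ : ι) (_ : N) => (1 : ℂ))
  simpa using this

omit [Fintype N] [DecidableEq ι] in
theorem piMatrix_zero_of_exists (A : ι → Matrix N N ℂ) {k : ι} (h : A k = 0) :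
    piMatrix A = 0 := by
  ext i j
  exact Finset.prod_eq_zero (Finset.mem_univ k) (by rw [h]; rfl)

/-- The sum of additive functions against a product distribution. -/
theorem sum_prod_mul_sum {X : Type} [Fintype X] (a g : X → ℝ) (ha : ∑ x, a x = 1) (l : ℕ) :
    ∑ x : Fin l → X, (∏ k, a (x k)) * ∑ k, g (x k) = l * ∑ x, a x * g x := by
  have h1 : ∀ k : Fin l, ∑ x : Fin l → X, (∏ i, a (x i)) * g (x k) = ∑ x, a x * g x := by
    intro k
    have h2 : ∀ x : Fin l → X, (∏ i, a (x i)) * g (x k) =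
        ∏ i, (if i = k then a (x i) * g (x i) else a (x i)) := by
      intro x
      rw [← Finset.mul_prod_erase _ _ (Finset.mem_univ k),
        ← Finset.mul_prod_erase _ _ (Finset.mem_univ k), if_pos rfl,
        Finset.prod_congr rfl fun i hi => if_neg (Finset.ne_of_mem_erase hi)]
      ring
    simp only [h2]
    have h3 := Finset.prod_univ_sum (fun _ : Fin l => (Finset.univ : Finset X))
      (fun i x => if i = k then a x * g x else a x)
    rw [Fintype.piFinset_univ] at h3
    rw [← h3, ← Finset.mul_prod_erase _ _ (Finset.mem_univ k),
      Finset.prod_eq_one (s := Finset.univ.erase k)]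
    · simp
    · intro i hi
      simp [Finset.ne_of_mem_erase hi, ha]
  simp only [Finset.mul_sum]
  rw [Finset.sum_comm, Finset.sum_congr rfl fun k _ => h1 k]
  simp [Finset.mul_sum]

end PiMatrix

/-! ### Constructions of projective measurements. -/

section PVMConstructions

variable {n n' X Y : Type} [Fintype n] [DecidableEq n] [Fintype n'] [DecidableEq n']
  [Fintype X] [Fintype Y]

theorem trace_proj_mul_eq_ofReal (M : PVM n X) (τ : DensityMatrix n) (x : X) :
    (M.proj x * τ.val).trace = (realProb M τ x : ℂ) := by
  have := (τ.posSemidef.mul_mul_conjTranspose_same (M.proj x)).trace_nonneg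
  rw [← trace_proj_mul] at this
  exact (Complex.ext rfl (Complex.le_def.mp this).2.symm)

/-- Renaming the outcomes of a measurement. -/
def PVM.relabel (M : PVM n X) (e : Y ≃ X) : PVM n Y where
  proj y := M.proj (e y)
  isStarProjection y := M.isStarProjection (e y)
  orthogonal x y h := M.orthogonal _ _ (e.injective.ne h)
  sum_eq_one := by rw [e.sum_comp M.proj, M.sum_eq_one]

theorem measuredEntropy_relabel (M : PVM n X) (e : Y ≃ X) (σ ρ : DensityMatrix n) :
    measuredEntropy (M.relabel e) σ ρ = measuredEntropy M σ ρ :=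
  e.sum_comp fun x => realProb M σ x * Real.log (realProb M σ x / realProb M ρ x)

/-- The trivial measurement. -/
def PVM.trivial : PVM n (Fin 1) where
  proj _ := 1
  isStarProjection _ := .one _
  orthogonal x y h := absurd (Subsingleton.elim x y) h
  sum_eq_one := by simp

/-- The measurement in the orthonormal basis of the columns of a unitary matrix. -/
def PVM.ofUnitary (V : Matrix n n ℂ) (h1 : Vᴴ * V = 1) (h2 : V * Vᴴ = 1) : PVM n n where
  proj x := V * Matrix.single x x 1 * Vᴴ
  isStarProjection x := by
    constructor
    · rw [IsIdempotentElem, show V * Matrix.single x x (1 : ℂ) * Vᴴ *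
        (V * Matrix.single x x 1 * Vᴴ) = V * Matrix.single x x 1 * (Vᴴ * V) *
        Matrix.single x x 1 * Vᴴ by simp only [Matrix.mul_assoc], h1, Matrix.mul_one,
        Matrix.mul_assoc V, Matrix.single_mul_single_same, mul_one]
    · rw [IsSelfAdjoint, Matrix.star_eq_conjTranspose, Matrix.conjTranspose_mul,
        Matrix.conjTranspose_mul, Matrix.conjTranspose_conjTranspose,
        Matrix.conjTranspose_single, star_one, Matrix.mul_assoc]
  orthogonal x y h := by
    rw [show V * Matrix.single x x (1 : ℂ) * Vᴴ *
        (V * Matrix.single y y 1 * Vᴴ) = V * Matrix.single x x 1 * (Vᴴ * V) *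
        Matrix.single y y 1 * Vᴴ by simp only [Matrix.mul_assoc], h1, Matrix.mul_one,
        Matrix.mul_assoc V, Matrix.single_mul_single_of_ne _ _ _ _ h, Matrix.mul_zero,
        Matrix.zero_mul]
  sum_eq_one := by
    rw [← Finset.sum_mul, ← Finset.mul_sum]
    have : ∑ x : n, Matrix.single x x (1 : ℂ) = 1 := by
      ext i j
      simp [Matrix.sum_apply, Matrix.single_apply, Matrix.one_apply, ite_and, eq_comm]
    rw [this, Matrix.mul_one, h2]

theorem realProb_ofUnitary (V : Matrix n n ℂ) (h1 : Vᴴ * V = 1) (h2 : V * Vᴴ = 1)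
    (τ : DensityMatrix n) (x : n) :
    realProb (PVM.ofUnitary V h1 h2) τ x = ((Vᴴ * τ.val * V) x x).re := by
  change ((V * Matrix.single x x 1 * Vᴴ) * τ.val).trace.re = _
  rw [Matrix.mul_assoc, Matrix.trace_mul_comm, ← Matrix.mul_assoc, Matrix.trace_mul_single]
  simp

end PVMConstructions

/-! ### Repeating a block measurement. -/

section PVMPow

variable {d l m : ℕ}

/-- Splitting `r * l` copies into `r` blocks of `l` copies. -/
def splitBlocks (r l d : ℕ) : (Fin (r * l) → Fin d) ≃ (Fin r → Fin l → Fin d) :=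
  (finProdFinEquiv.symm.arrowCongr (Equiv.refl _)).trans (Equiv.curry _ _ _)

theorem tensorMatrix_eq_submatrix (r l : ℕ) (A : Matrix (Fin d) (Fin d) ℂ) :
    tensorMatrix (fun _ : Fin (r * l) => A) =
      (piMatrix fun _ : Fin r => tensorMatrix fun _ : Fin l => A).submatrix
        (splitBlocks r l d) (splitBlocks r l d) := by
  ext i j
  simp only [tensorMatrix, piMatrix, Matrix.submatrix_apply, splitBlocks]
  rw [← finProdFinEquiv.prod_comp, Fintype.prod_prod_type]
  rfl

/-- Measuring each of `r` successive blocks with `M`. -/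
def PVM.pow (M : PVM (Fin l → Fin d) (Fin m)) (r : ℕ) :
    PVM (Fin (r * l) → Fin d) (Fin r → Fin m) where
  proj x := (piMatrix fun k => M.proj (x k)).submatrix (splitBlocks r l d) (splitBlocks r l d)
  isStarProjection x := by
    constructor
    · rw [IsIdempotentElem, Matrix.submatrix_mul_equiv, piMatrix_mul]
      simp only [(M.isStarProjection _).isIdempotentElem.eq]
    · rw [IsSelfAdjoint, Matrix.star_eq_conjTranspose, Matrix.conjTranspose_submatrix,
        piMatrix_conjTranspose]
      congr 2
      funext k
      exact (M.isStarProjection (x k)).isSelfAdjoint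
  orthogonal x y h := by
    obtain ⟨k, hk⟩ := Function.ne_iff.mp h
    rw [Matrix.submatrix_mul_equiv, piMatrix_mul,
      piMatrix_zero_of_exists (fun k => M.proj (x k) * M.proj (y k)) (k := k)
        (M.orthogonal _ _ hk)]
    rfl
  sum_eq_one := by
    have : ∀ x : Fin r → Fin m, (piMatrix fun k => M.proj (x k)).submatrix
        (splitBlocks r l d) (splitBlocks r l d) =
        Matrix.reindexLinearEquiv ℂ ℂ (splitBlocks r l d).symm (splitBlocks r l d).symm
          (piMatrix fun k => M.proj (x k)) := fun x => rfl
    simp only [this]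
    rw [← map_sum, sum_piMatrix, M.sum_eq_one, piMatrix_one]
    exact Matrix.submatrix_one_equiv _

theorem realProb_pow (M : PVM (Fin l → Fin d) (Fin m)) (r : ℕ) (τ : DensityMatrix (Fin d))
    (x : Fin r → Fin m) :
    realProb (M.pow r) (iidState (r * l) τ) x = ∏ k, realProb M (iidState l τ) (x k) := by
  have h := trace_proj_mul_eq_ofReal (M.pow r) (iidState (r * l) τ) x
  have h2 : ((M.pow r).proj x * (iidState (r * l) τ).val).trace =
      ∏ k, (M.proj (x k) * (iidState l τ).val).trace := by
    change ((piMatrix fun k => M.proj (x k)).submatrix _ _ * tensorMatrix _).trace = _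
    rw [tensorMatrix_eq_submatrix, Matrix.submatrix_mul_equiv, piMatrix_mul, ← trace_piMatrix]
    exact (splitBlocks r l d).sum_comp fun i => (piMatrix fun k => M.proj (x k) *
      (iidState l τ).val) i i
  rw [h2] at h
  simp only [trace_proj_mul_eq_ofReal] at h
  exact_mod_cast h.symm

/-- The outcomes of the `r` blocks are independent and identically distributed, so relative entropy
adds up. Hence a measurement can be moved to any positive multiple of its block length at the same
rate per copy. -/
theorem measuredEntropy_pow (M : PVM (Fin l → Fin d) (Fin m)) (r : ℕ)
    {ρ σ : DensityMatrix (Fin d)} (hac : OutcomesAC M (iidState l σ) (iidState l ρ)) :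
    measuredEntropy (M.pow r) (iidState (r * l) σ) (iidState (r * l) ρ) =
      r * measuredEntropy M (iidState l σ) (iidState l ρ) := by
  unfold measuredEntropy
  rw [← sum_prod_mul_sum _ (fun x => Real.log (realProb M (iidState l σ) x /
    realProb M (iidState l ρ) x)) (sum_realProb M _) r]
  refine Finset.sum_congr rfl fun x _ => ?_
  rw [realProb_pow, realProb_pow]
  by_cases h : ∏ k, realProb M (iidState l σ) (x k) = 0
  · rw [h, zero_mul, zero_mul]
  · rw [← Finset.prod_div_distrib, Real.log_prod]
    intro k hk
    have h1 := Finset.prod_ne_zero_iff.mp h k hk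
    exact div_ne_zero h1 fun h2 => h1 (hac _ h2)

end PVMPow

/-! ### Relative entropy in eigenbases, and Klein's inequality. -/

section Spectral

variable {n : Type} [Fintype n] [DecidableEq n]

/-- The diagonal matrix with real entries `f`. -/
noncomputable def realDiagonal (f : n → ℝ) : Matrix n n ℂ := Matrix.diagonal fun i => (f i : ℂ)

theorem mul_realDiagonal_apply (A : Matrix n n ℂ) (f : n → ℝ) (i j : n) :
    (A * realDiagonal f) i j = A i j * f j :=
  Matrix.mul_diagonal _ _ _ _

theorem conj_realDiagonal_apply (G : Matrix n n ℂ) (f : n → ℝ) (i k : n) :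
    (G * realDiagonal f * Gᴴ) i k = ∑ j, G i j * f j * star (G k j) := by
  rw [Matrix.mul_apply]
  simp only [realDiagonal, Matrix.mul_diagonal, Matrix.conjTranspose_apply]

theorem conj_realDiagonal_apply_self (G : Matrix n n ℂ) (f : n → ℝ) (i : n) :
    (G * realDiagonal f * Gᴴ) i i = ((∑ j, Complex.normSq (G i j) * f j : ℝ) : ℂ) := by
  rw [conj_realDiagonal_apply]
  push_cast
  refine Finset.sum_congr rfl fun j _ => ?_
  rw [mul_right_comm, ← Complex.mul_conj]
  rfl

theorem trace_mul_realDiagonal (A : Matrix n n ℂ) (f : n → ℝ) :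
    (A * realDiagonal f).trace = ∑ i, A i i * f i := by
  simp [Matrix.trace, realDiagonal, Matrix.mul_diagonal]

theorem sum_normSq_row {G : Matrix n n ℂ} (h : G * Gᴴ = 1) (i : n) :
    ∑ j, Complex.normSq (G i j) = 1 := by
  have h1 := congrFun (congrFun h i) i
  have h2 := conj_realDiagonal_apply_self G (fun _ => 1) i
  have h3 : realDiagonal (fun _ : n => (1 : ℝ)) = 1 := by simp [realDiagonal]
  rw [h3, Matrix.mul_one, h, Matrix.one_apply_eq] at h2
  have h4 : (1 : ℝ) = ∑ j, Complex.normSq (G i j) * 1 := by exact_mod_cast h2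
  simpa using h4.symm

theorem sum_normSq_col {G : Matrix n n ℂ} (h : Gᴴ * G = 1) (j : n) :
    ∑ i, Complex.normSq (G i j) = 1 := by
  have h1 := sum_normSq_row (G := Gᴴ) (by rwa [Matrix.conjTranspose_conjTranspose]) j
  simpa [Matrix.conjTranspose_apply, Complex.normSq_conj] using h1

theorem trace_conj {U : Matrix n n ℂ} (h : Uᴴ * U = 1) (A : Matrix n n ℂ) :
    (U * A * Uᴴ).trace = A.trace := by
  rw [Matrix.trace_mul_comm, ← Matrix.mul_assoc, h, Matrix.one_mul]

theorem exists_spectral (τ : DensityMatrix n) : ∃ (U : Matrix n n ℂ) (r : n → ℝ),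
    Uᴴ * U = 1 ∧ U * Uᴴ = 1 ∧ (∀ i, 0 ≤ r i) ∧ ∑ i, r i = 1 ∧
    τ.val = U * realDiagonal r * Uᴴ ∧
    cfc Real.log τ.val = U * realDiagonal (fun i => Real.log (r i)) * Uᴴ := by
  have hH := τ.posSemidef.isHermitian
  have h1 : (hH.eigenvectorUnitary : Matrix n n ℂ)ᴴ * hH.eigenvectorUnitary = 1 :=
    Unitary.coe_star_mul_self _
  have hs : τ.val = (hH.eigenvectorUnitary : Matrix n n ℂ) * realDiagonal hH.eigenvalues *
      (hH.eigenvectorUnitary : Matrix n n ℂ)ᴴ := by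
    conv_lhs => rw [hH.spectral_theorem]
    rfl
  refine ⟨hH.eigenvectorUnitary, hH.eigenvalues, h1, Unitary.coe_mul_star_self _,
    τ.posSemidef.eigenvalues_nonneg, ?_, hs, ?_⟩
  · have h2 := τ.trace_eq_one
    rw [hs, trace_conj h1] at h2
    simp only [realDiagonal, Matrix.trace_diagonal] at h2
    exact_mod_cast h2
  · rw [hH.cfc_eq]
    rfl

theorem relEntropy_lt_top_iff (σ ρ : DensityMatrix n) :
    relEntropy σ ρ < ⊤ ↔ ∀ v : n → ℂ, ρ.val *ᵥ v = 0 → σ.val *ᵥ v = 0 := by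
  unfold relEntropy
  split_ifs with h
  · exact iff_of_true (EReal.coe_lt_top _) h
  · exact iff_of_false (lt_irrefl _) h

/-- The states `ρ = U diag(r) Uᴴ` and `σ = U G diag(s) Gᴴ Uᴴ` in an eigenbasis of `ρ`, and their
relative entropy in terms of the eigenvalues and of the overlaps of the eigenvectors. -/
theorem exists_frame {σ ρ : DensityMatrix n} (hfin : relEntropy σ ρ < ⊤) :
    ∃ (U G : Matrix n n ℂ) (r s : n → ℝ),
      Uᴴ * U = 1 ∧ U * Uᴴ = 1 ∧ Gᴴ * G = 1 ∧ G * Gᴴ = 1 ∧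
      (∀ i, 0 ≤ r i) ∧ (∀ j, 0 ≤ s j) ∧ ∑ i, r i = 1 ∧ ∑ j, s j = 1 ∧
      ρ.val = U * realDiagonal r * Uᴴ ∧ σ.val = U * (G * realDiagonal s * Gᴴ) * Uᴴ ∧
      (∀ i, r i = 0 → ∀ j, Complex.normSq (G i j) * s j = 0) ∧
      (relEntropy σ ρ).toReal = ∑ j, s j * Real.log (s j) -
        ∑ i, (∑ j, Complex.normSq (G i j) * s j) * Real.log (r i) := by
  obtain ⟨U, r, hU1, hU2, hr, hr1, hρ, hρlog⟩ := exists_spectral ρ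
  obtain ⟨F, s, hF1, hF2, hs, hs1, hσ, hσlog⟩ := exists_spectral σ
  have hker := (relEntropy_lt_top_iff σ ρ).mp hfin
  have hFU : F = U * (Uᴴ * F) := by rw [← Matrix.mul_assoc, hU2, Matrix.one_mul]
  have hσ2 : σ.val = U * ((Uᴴ * F) * realDiagonal s * (Uᴴ * F)ᴴ) * Uᴴ := by
    rw [hσ]
    conv_lhs => rw [hFU]
    rw [Matrix.conjTranspose_mul U]
    simp only [Matrix.mul_assoc]
  have hG1 : (Uᴴ * F)ᴴ * (Uᴴ * F) = 1 := by
    rw [Matrix.conjTranspose_mul, Matrix.conjTranspose_conjTranspose, Matrix.mul_assoc,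
      ← Matrix.mul_assoc U, hU2, Matrix.one_mul, hF1]
  have hG2 : (Uᴴ * F) * (Uᴴ * F)ᴴ = 1 := by
    rw [Matrix.conjTranspose_mul, Matrix.conjTranspose_conjTranspose, Matrix.mul_assoc,
      ← Matrix.mul_assoc F, hF2, Matrix.one_mul, hU1]
  generalize Uᴴ * F = G at hσ2 hG1 hG2
  refine ⟨U, G, r, s, hU1, hU2, hG1, hG2, hr, hs, hr1, hs1, hρ, hσ2, ?_, ?_⟩
  · intro i hi
    -- Column `i` of `U` lies in the kernel of `ρ`, hence of `σ`. The diagonal entry of `σ` there is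
    -- a sum of nonnegative terms, so each of them vanishes.
    have h1 : ρ.val *ᵥ (U *ᵥ Pi.single i 1) = 0 := by
      rw [hρ, Matrix.mulVec_mulVec, Matrix.mul_assoc, hU1, Matrix.mul_one, ← Matrix.mulVec_mulVec,
        realDiagonal, Matrix.diagonal_mulVec_single, hi]
      simp
    have h2 := congrArg (fun v => Uᴴ *ᵥ v) (hker _ h1)
    simp only [Matrix.mulVec_zero, Matrix.mulVec_mulVec] at h2
    rw [hσ2, show Uᴴ * (U * (G * realDiagonal s * Gᴴ) * Uᴴ * U) =
      (Uᴴ * U) * (G * realDiagonal s * Gᴴ) * (Uᴴ * U) by simp only [Matrix.mul_assoc],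
      hU1, Matrix.one_mul, Matrix.mul_one] at h2
    have h3 := congrFun h2 i
    rw [Matrix.mulVec_single_one, Matrix.col_apply, conj_realDiagonal_apply_self,
      Pi.zero_apply] at h3
    have h4 : ∑ j, Complex.normSq (G i j) * s j = 0 := by exact_mod_cast h3
    intro j
    exact (Finset.sum_eq_zero_iff_of_nonneg fun j _ =>
      mul_nonneg (Complex.normSq_nonneg _) (hs j)).mp h4 j (Finset.mem_univ j)
  · rw [relEntropy, if_pos hker, EReal.toReal_coe, Matrix.mul_sub, Matrix.trace_sub,
      Complex.sub_re]
    congr 1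
    · rw [hσlog, hσ, show F * realDiagonal s * Fᴴ * (F * realDiagonal (fun i => Real.log (s i)) *
        Fᴴ) = F * (realDiagonal s * (Fᴴ * F) * realDiagonal (fun i => Real.log (s i))) * Fᴴ by
          simp only [Matrix.mul_assoc], hF1, Matrix.mul_one, trace_conj hF1,
          trace_mul_realDiagonal]
      rw [Complex.re_sum]
      refine Finset.sum_congr rfl fun j _ => ?_
      rw [realDiagonal, Matrix.diagonal_apply_eq, ← Complex.ofReal_mul, Complex.ofReal_re]
    · rw [hρlog, hσ2, show U * (G * realDiagonal s * Gᴴ) * Uᴴ *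
        (U * realDiagonal (fun i => Real.log (r i)) * Uᴴ) = U * ((G * realDiagonal s * Gᴴ) *
          (Uᴴ * U) * realDiagonal (fun i => Real.log (r i))) * Uᴴ by
          simp only [Matrix.mul_assoc], hU1, Matrix.mul_one, trace_conj hU1,
          trace_mul_realDiagonal]
      rw [Complex.re_sum]
      refine Finset.sum_congr rfl fun j _ => ?_
      rw [conj_realDiagonal_apply_self, ← Complex.ofReal_mul, Complex.ofReal_re]

/-- Klein's inequality, with its case of equality. -/
theorem relEntropy_pos {σ ρ : DensityMatrix n} (hfin : relEntropy σ ρ < ⊤) (hne : σ ≠ ρ) :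
    0 < (relEntropy σ ρ).toReal := by
  obtain ⟨U, G, r, s, hU1, hU2, hG1, hG2, hr, hs, hr1, hs1, hρ, hσ, hsupp, hD⟩ :=
    exists_frame hfin
  -- The weights `|G i j|²` are doubly stochastic and both spectra sum to 1, so subtracting `s j - r
  -- i` changes nothing in total while making every term nonnegative.
  have hD2 : (relEntropy σ ρ).toReal = ∑ j, ∑ i, Complex.normSq (G i j) *
      (s j * Real.log (s j) - s j * Real.log (r i) - (s j - r i)) := by
    have e1 : ∑ j, ∑ i, Complex.normSq (G i j) * (s j - r i) = 0 := by
      simp only [mul_sub, Finset.sum_sub_distrib]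
      rw [sub_eq_zero, Finset.sum_congr rfl fun j _ => (Finset.sum_mul _ _ _).symm]
      rw [Finset.sum_comm, Finset.sum_congr rfl fun i _ => (Finset.sum_mul _ _ _).symm]
      simp only [sum_normSq_row hG2, sum_normSq_col hG1, one_mul, hs1, hr1]
    have e2 : ∑ j, ∑ i, Complex.normSq (G i j) * (s j * Real.log (s j)) =
        ∑ j, s j * Real.log (s j) := by
      refine Finset.sum_congr rfl fun j _ => ?_
      rw [← Finset.sum_mul, sum_normSq_col hG1, one_mul]
    have e3 : ∑ j, ∑ i, Complex.normSq (G i j) * (s j * Real.log (r i)) =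
        ∑ i, (∑ j, Complex.normSq (G i j) * s j) * Real.log (r i) := by
      rw [Finset.sum_comm]
      refine Finset.sum_congr rfl fun i _ => ?_
      rw [Finset.sum_mul]
      exact Finset.sum_congr rfl fun j _ => (mul_assoc _ _ _).symm
    rw [hD, ← e2, ← e3]
    simp only [mul_sub, Finset.sum_sub_distrib] at e1 ⊢
    linarith
  have hterm : ∀ i j, 0 ≤ Complex.normSq (G i j) *
      (s j * Real.log (s j) - s j * Real.log (r i) - (s j - r i)) ∧
      (Complex.normSq (G i j) *
        (s j * Real.log (s j) - s j * Real.log (r i) - (s j - r i)) = 0 →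
        Complex.normSq (G i j) = 0 ∨ s j = r i) := by
    intro i j
    rcases (hs j).eq_or_lt' with h0 | h0
    · rw [h0]
      simp only [zero_mul, sub_zero, zero_sub, neg_neg]
      refine ⟨mul_nonneg (Complex.normSq_nonneg _) (hr i), fun h => ?_⟩
      rcases mul_eq_zero.mp h with h | h
      · exact Or.inl h
      · exact Or.inr h.symm
    rcases (hr i).eq_or_lt' with h1 | h1
    · have h2 : Complex.normSq (G i j) = 0 :=
        (mul_eq_zero.mp (hsupp i h1 j)).resolve_right h0.ne'
      rw [h2]
      simp
    · have h2 : s j * Real.log (s j) - s j * Real.log (r i) - (s j - r i) =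
          s j * ((r i / s j - 1) - Real.log (r i / s j)) := by
        rw [Real.log_div h1.ne' h0.ne']
        field_simp
        ring
      rw [h2]
      refine ⟨mul_nonneg (Complex.normSq_nonneg _) (mul_nonneg h0.le (sub_nonneg.mpr
        (Real.log_le_sub_one_of_pos (by positivity)))), fun h => ?_⟩
      rcases mul_eq_zero.mp h with h | h
      · exact Or.inl h
      · right
        by_contra hne2
        have h3 := Real.log_lt_sub_one_of_pos (x := r i / s j) (by positivity)
          (fun h => hne2 ((div_eq_one_iff_eq h0.ne').mp h).symm)
        exact absurd h (mul_pos h0 (by linarith)).ne'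
  refine lt_of_le_of_ne (hD2 ▸ Finset.sum_nonneg fun j _ => Finset.sum_nonneg fun i _ =>
    (hterm i j).1) fun h0 => hne ?_
  have hall : ∀ i j, Complex.normSq (G i j) = 0 ∨ s j = r i := by
    intro i j
    rw [hD2] at h0
    have h1 := (Finset.sum_eq_zero_iff_of_nonneg fun j _ => Finset.sum_nonneg fun i _ =>
      (hterm i j).1).mp h0.symm j (Finset.mem_univ j)
    exact (hterm i j).2 ((Finset.sum_eq_zero_iff_of_nonneg fun i _ =>
      (hterm i j).1).mp h1 i (Finset.mem_univ i))
  -- Equality forces `s j = r i` wherever `G i j ≠ 0`, so `G` intertwines the two spectra and the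
  -- states coincide.
  have hcomm : G * realDiagonal s = realDiagonal r * G := by
    ext i j
    simp only [realDiagonal, Matrix.mul_diagonal, Matrix.diagonal_mul]
    rcases hall i j with h | h
    · rw [Complex.normSq_eq_zero.mp h]; simp
    · rw [h, mul_comm]
  have hval : σ.val = ρ.val := by
    rw [hσ, hρ, hcomm, Matrix.mul_assoc (realDiagonal r), hG2, Matrix.mul_one]
  cases σ; cases ρ
  simp only at hval
  subst hval
  rfl

end Spectral

/-! ### Finite relative entropy and impossible outcomes. -/

section AbsoluteContinuity

variable {d : ℕ}

/-- With `τ = Bᴴ * B`, the probability is the squared Hilbert–Schmidt norm of `B * M.proj x`. -/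
theorem mul_proj_eq_zero {n X : Type} [Fintype n] [DecidableEq n] [Fintype X] (M : PVM n X)
    (τ : DensityMatrix n) (x : X) : realProb M τ x = 0 ↔ τ.val * M.proj x = 0 := by
  have hx : (M.proj x)ᴴ = M.proj x := (M.isStarProjection x).isSelfAdjoint
  constructor
  · intro h
    have h1 := trace_proj_mul_eq_ofReal M τ x
    rw [h, trace_proj_mul] at h1
    obtain ⟨B, hB⟩ := exists_conjTranspose_mul_self τ.posSemidef
    have h2 : M.proj x * τ.val * (M.proj x)ᴴ = (B * M.proj x)ᴴ * (B * M.proj x) := by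
      rw [hB, Matrix.conjTranspose_mul, hx]
      simp only [Matrix.mul_assoc]
    rw [h2, Complex.ofReal_zero, Matrix.trace_conjTranspose_mul_self_eq_zero_iff] at h1
    rw [hB, Matrix.mul_assoc, h1, Matrix.mul_zero]
  · intro h
    rw [realProb, Matrix.trace_mul_comm, h]
    simp

/-- `K` is `σ` times the pseudo-inverse of `ρ`, since `(r i)⁻¹ = 0` on the kernel, where `σ`
vanishes anyway. Unlike an inclusion of kernels, the factorization passes to tensor powers at once.
-/
theorem exists_mul_of_relEntropy_lt_top {n : Type} [Fintype n] [DecidableEq n]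
    {σ ρ : DensityMatrix n} (hfin : relEntropy σ ρ < ⊤) :
    ∃ K : Matrix n n ℂ, σ.val = K * ρ.val := by
  obtain ⟨U, G, r, s, hU1, -, -, -, -, -, -, -, hρ, hσ, hsupp, -⟩ := exists_frame hfin
  refine ⟨U * (G * realDiagonal s * Gᴴ) * realDiagonal (fun i => (r i)⁻¹) * Uᴴ, ?_⟩
  have h : G * realDiagonal s * Gᴴ * realDiagonal (fun i => (r i)⁻¹) * realDiagonal r =
      G * realDiagonal s * Gᴴ := by
    ext k i
    rw [mul_realDiagonal_apply, mul_realDiagonal_apply]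
    by_cases hi : r i = 0
    · have h0 : (G * realDiagonal s * Gᴴ) k i = 0 := by
        rw [conj_realDiagonal_apply]
        refine Finset.sum_eq_zero fun j _ => ?_
        rcases mul_eq_zero.mp (hsupp i hi j) with h1 | h1
        · rw [Complex.normSq_eq_zero.mp h1]; simp
        · rw [h1]; simp
      rw [h0]; simp
    · rw [mul_assoc, ← Complex.ofReal_mul, inv_mul_cancel₀ hi]; simp
  rw [hσ, hρ, show U * (G * realDiagonal s * Gᴴ) * realDiagonal (fun i => (r i)⁻¹) * Uᴴ *
    (U * realDiagonal r * Uᴴ) = U * (G * realDiagonal s * Gᴴ *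
      realDiagonal (fun i => (r i)⁻¹) * (Uᴴ * U) * realDiagonal r) * Uᴴ by
    simp only [Matrix.mul_assoc], hU1, Matrix.mul_one, h]

/-- If `D(σ‖ρ) < ∞`, the outcomes impossible on `ρ^{⊗ l}` are impossible on `σ^{⊗ l}`. -/
theorem outcomesAC_of_relEntropy_lt_top {X : Type} [Fintype X] {l : ℕ}
    (M : PVM (Fin l → Fin d) X) {σ ρ : DensityMatrix (Fin d)} (hfin : relEntropy σ ρ < ⊤) :
    OutcomesAC M (iidState l σ) (iidState l ρ) := by
  obtain ⟨K, hK⟩ := exists_mul_of_relEntropy_lt_top hfin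
  intro x hx
  rw [mul_proj_eq_zero] at hx ⊢
  have : (iidState l σ).val = tensorMatrix (fun _ : Fin l => K) * (iidState l ρ).val := by
    change tensorMatrix (fun _ => σ.val) = _ * tensorMatrix (fun _ => ρ.val)
    rw [← tensorMatrix_mul, hK]
  rw [this, Matrix.mul_assoc, hx, Matrix.mul_zero]

end AbsoluteContinuity

/-! ### Block diagonalization and the entropy cost of pinching. -/

section Pinching

variable {n κ : Type} [Fintype n] [DecidableEq n]

omit [DecidableEq n] in
theorem sum_eq_sum_subtype {M : Type*} [AddCommMonoid M] (f : n → M) (p : n → Prop)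
    [DecidablePred p] (h : ∀ k, ¬ p k → f k = 0) : ∑ k, f k = ∑ k : {k // p k}, f k := by
  rw [← Finset.sum_subtype (Finset.univ.filter p) (by simp) f, Finset.sum_filter_of_ne]
  exact fun k _ hk => by_contra fun hp => hk (h k hp)

/-- The diagonal blocks of a Hermitian matrix are diagonalized by a block diagonal unitary. -/
theorem exists_block_diagonalization [DecidableEq κ] (b : n → κ) {A : Matrix n n ℂ}
    (hA : A.IsHermitian) : ∃ W : Matrix n n ℂ, Wᴴ * W = 1 ∧ W * Wᴴ = 1 ∧
      (∀ i j, b i ≠ b j → W i j = 0) ∧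
      ∀ i j, i ≠ j → b i = b j → (Wᴴ * A * W) i j = 0 := by
  have hB : ∀ t, (A.submatrix (Subtype.val : {x // b x = t} → n) Subtype.val).IsHermitian :=
    fun t => hA.submatrix _
  let V : ∀ t, Matrix {x // b x = t} {x // b x = t} ℂ := fun t => (hB t).eigenvectorUnitary
  have hV : ∀ t, (V t)ᴴ * V t = 1 := fun t => Unitary.coe_star_mul_self _
  have hVA : ∀ t, (V t)ᴴ * A.submatrix Subtype.val Subtype.val * V t =
      Matrix.diagonal fun i => ((hB t).eigenvalues i : ℂ) := fun t => by
    have := (hB t).conjStarAlgAut_star_eigenvectorUnitary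
    rw [Unitary.conjStarAlgAut_star_apply] at this
    exact this
  let W : Matrix n n ℂ := fun i j => if h : b i = b j then V (b j) ⟨i, h⟩ ⟨j, rfl⟩ else 0
  have hW : ∀ t i j (hi : b i = t) (hj : b j = t), W i j = V t ⟨i, hi⟩ ⟨j, hj⟩ := by
    intro t i j hi hj
    subst hj
    simp only [W, hi, dif_pos]
  have hW0 : ∀ i j, b i ≠ b j → W i j = 0 := fun i j h => by
    simp only [W, h, dif_neg, not_false_eq_true]
  have h1 : Wᴴ * W = 1 := by
    ext i j
    rw [Matrix.mul_apply]
    by_cases hij : b i = b j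
    · rw [sum_eq_sum_subtype _ (fun k => b k = b j) fun k hk => by rw [hW0 k j hk, mul_zero]]
      have h2 := congrFun (congrFun (hV (b j)) ⟨i, hij⟩) ⟨j, rfl⟩
      rw [Matrix.mul_apply] at h2
      rw [Matrix.one_apply] at h2 ⊢
      simp only [Subtype.mk.injEq] at h2
      rw [← h2]
      refine Finset.sum_congr rfl fun k _ => ?_
      rw [Matrix.conjTranspose_apply, Matrix.conjTranspose_apply, hW (b j) k i k.2 hij,
        hW (b j) k j k.2 rfl]
    · rw [Matrix.one_apply_ne fun h => hij (by rw [h])]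
      refine Finset.sum_eq_zero fun k _ => ?_
      by_cases hk : b k = b j
      · rw [Matrix.conjTranspose_apply, hW0 k i fun h => hij (h.symm.trans hk)]
        simp
      · rw [hW0 k j hk, mul_zero]
  refine ⟨W, h1, mul_eq_one_comm.mp h1, hW0, fun i j hij hb => ?_⟩
  have h2 := congrFun (congrFun (hVA (b j)) ⟨i, hb⟩) ⟨j, rfl⟩
  rw [Matrix.diagonal_apply_ne _ fun h => hij (congrArg Subtype.val h)] at h2
  rw [← h2, Matrix.mul_apply, Matrix.mul_apply,
    sum_eq_sum_subtype _ (fun k => b k = b j) fun k hk => by rw [hW0 k j hk, mul_zero]]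
  refine Finset.sum_congr rfl fun k _ => ?_
  rw [hW (b j) k j k.2 rfl]
  congr 1
  rw [Matrix.mul_apply, Matrix.mul_apply, sum_eq_sum_subtype _ (fun k => b k = b j) fun k hk => by
    rw [Matrix.conjTranspose_apply, hW0 k i fun h => hk (h.trans hb), star_zero, zero_mul]]
  refine Finset.sum_congr rfl fun k' _ => ?_
  rw [Matrix.conjTranspose_apply, Matrix.conjTranspose_apply, hW (b j) k' i k'.2 hb]
  rfl

/-- Pinching to `card κ` blocks increases the entropy by at most `log (card κ)`. -/
theorem sum_mul_log_pinching_ge [Fintype κ] [DecidableEq κ] [Nonempty κ] (b : n → κ)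
    {E : Matrix n n ℂ} (hE1 : Eᴴ * E = 1) {s : n → ℝ} (hs : ∀ j, 0 ≤ s j)
    (hs1 : ∑ j, s j = 1)
    (hoff : ∀ i k, i ≠ k → b i = b k → (E * realDiagonal s * Eᴴ) i k = 0) :
    ∑ j, s j * Real.log (s j) - Real.log (Fintype.card κ) ≤
      ∑ i, (∑ j, Complex.normSq (E i j) * s j) *
        Real.log (∑ j, Complex.normSq (E i j) * s j) := by
  set q : n → ℝ := fun i => ∑ j, Complex.normSq (E i j) * s j with hq
  have hq0 : ∀ i, 0 ≤ q i := fun i => Finset.sum_nonneg fun j _ =>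
    mul_nonneg (Complex.normSq_nonneg _) (hs j)
  have hqle : ∀ i j, Complex.normSq (E i j) * s j ≤ q i := fun i j =>
    Finset.single_le_sum (f := fun j => Complex.normSq (E i j) * s j)
      (fun j _ => mul_nonneg (Complex.normSq_nonneg _) (hs j)) (Finset.mem_univ j)
  have hv : (0 : ℝ) < Fintype.card κ := by exact_mod_cast Fintype.card_pos
  -- Inside a block the matrix is diagonal with entries `q`. If `a` denotes the left side, the
  -- vector `c` below satisfies `∑ s j' |c j'|² = a` and `c j = a`; keeping the single term `j`
  -- gives `s j * a² ≤ a`.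
  have hblock : ∀ j, 0 < s j → ∀ t,
      ∑ i with b i = t, Complex.normSq (E i j) / q i ≤ 1 / s j := by
    intro j hj t
    set a := ∑ i with b i = t, Complex.normSq (E i j) / q i with ha
    have ha0 : 0 ≤ a := Finset.sum_nonneg fun i _ => div_nonneg (Complex.normSq_nonneg _) (hq0 i)
    let c : n → ℂ := fun j' => ∑ i with b i = t, star (E i j) / (q i : ℂ) * E i j'
    have hcj : c j = (a : ℂ) := by
      rw [ha]
      push_cast
      refine Finset.sum_congr rfl fun i _ => ?_
      rw [← Complex.mul_conj, div_mul_eq_mul_div, mul_comm (E i j)]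
      rfl
    have hsum : ((∑ j', s j' * Complex.normSq (c j') : ℝ) : ℂ) = (a : ℂ) := by
      have h1 : ∀ j', ((s j' * Complex.normSq (c j') : ℝ) : ℂ) =
          ∑ i with b i = t, ∑ k with b k = t, star (E i j) / (q i : ℂ) * (E k j / (q k : ℂ)) *
            (E i j' * s j' * star (E k j')) := by
        intro j'
        have hconj : star (c j') = ∑ k with b k = t, E k j / (q k : ℂ) * star (E k j') := by
          simp only [c, star_sum]
          refine Finset.sum_congr rfl fun k _ => ?_
          simp
        rw [Complex.ofReal_mul, ← Complex.mul_conj]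
        change (s j' : ℂ) * (c j' * star (c j')) = _
        rw [hconj, Finset.sum_mul_sum, Finset.mul_sum]
        refine Finset.sum_congr rfl fun i _ => ?_
        rw [Finset.mul_sum]
        exact Finset.sum_congr rfl fun k _ => by ring
      rw [Complex.ofReal_sum, Finset.sum_congr rfl fun j' _ => h1 j', Finset.sum_comm, ha]
      push_cast
      refine Finset.sum_congr rfl fun i hi => ?_
      rw [Finset.sum_comm, Finset.sum_eq_single i]
      · rw [← Finset.mul_sum, ← conj_realDiagonal_apply, conj_realDiagonal_apply_self]
        change _ * ((q i : ℝ) : ℂ) = _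
        by_cases h0 : q i = 0
        · rw [h0]; simp
        · have : (q i : ℂ) ≠ 0 := by exact_mod_cast h0
          rw [← Complex.mul_conj]
          change star (E i j) / (q i : ℂ) * (E i j / (q i : ℂ)) * (q i : ℂ) =
            E i j * star (E i j) / (q i : ℂ)
          field_simp
      · intro k hk hki
        rw [← Finset.mul_sum, ← conj_realDiagonal_apply, hoff i k (Ne.symm hki), mul_zero]
        rw [(Finset.mem_filter.mp hi).2, (Finset.mem_filter.mp hk).2]
      · exact fun h => absurd hi h
    have hsum2 : ∑ j', s j' * Complex.normSq (c j') = a := by exact_mod_cast hsum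
    have h3 : s j * (a * a) ≤ a := by
      calc s j * (a * a) = s j * Complex.normSq (c j) := by rw [hcj, Complex.normSq_ofReal]
        _ ≤ ∑ j', s j' * Complex.normSq (c j') :=
          Finset.single_le_sum (f := fun j' => s j' * Complex.normSq (c j'))
            (fun j' _ => mul_nonneg (hs j') (Complex.normSq_nonneg _)) (Finset.mem_univ j)
        _ = a := hsum2
    rw [le_div_iff₀ hj]
    rcases ha0.eq_or_lt' with h4 | h4
    · rw [h4]; simp
    · nlinarith
  -- Adding `hblock` over the blocks bounds the mean of `1 / q i` under the weights `|E i j|²` by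
  -- `card κ / s j`. Jensen's inequality for the logarithm follows from `log x ≤ x - 1` at `x = c /
  -- q i`.
  have hone : ∀ j, 0 < s j → Real.log (s j) - Real.log (Fintype.card κ) ≤
      ∑ i, Complex.normSq (E i j) * Real.log (q i) := by
    intro j hj
    have h1 : ∑ i, Complex.normSq (E i j) / q i ≤ Fintype.card κ / s j := by
      rw [← Finset.sum_fiberwise Finset.univ b]
      refine (Finset.sum_le_sum fun t _ => hblock j hj t).trans (le_of_eq ?_)
      simp [div_eq_mul_inv]
    set c := s j / Fintype.card κ with hc
    have hc0 : 0 < c := div_pos hj hv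
    rw [← Real.log_div hj.ne' hv.ne', ← hc]
    have h2 : ∀ i, Complex.normSq (E i j) * (Real.log c - Real.log (q i)) ≤
        c * (Complex.normSq (E i j) / q i) - Complex.normSq (E i j) := by
      intro i
      rcases (Complex.normSq_nonneg (E i j)).eq_or_lt' with h0 | h0
      · rw [h0]; simp
      · have hqi : 0 < q i := lt_of_lt_of_le (mul_pos h0 hj) (hqle i j)
        have h3 := Real.log_le_sub_one_of_pos (div_pos hc0 hqi)
        rw [Real.log_div hc0.ne' hqi.ne'] at h3
        calc _ ≤ Complex.normSq (E i j) * (c / q i - 1) :=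
              mul_le_mul_of_nonneg_left h3 h0.le
          _ = _ := by ring
    have h4 := Finset.sum_le_sum fun i (_ : i ∈ Finset.univ) => h2 i
    simp only [mul_sub, Finset.sum_sub_distrib] at h4
    rw [← Finset.sum_mul, ← Finset.mul_sum, sum_normSq_col hE1] at h4
    have h5 : c * ∑ i, Complex.normSq (E i j) / q i ≤ 1 := by
      calc _ ≤ c * (Fintype.card κ / s j) := mul_le_mul_of_nonneg_left h1 hc0.le
        _ = 1 := by rw [hc]; field_simp
    linarith
  have hsplit : ∑ i, q i * Real.log (q i) =
      ∑ j, s j * ∑ i, Complex.normSq (E i j) * Real.log (q i) := by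
    simp only [Finset.mul_sum]
    rw [Finset.sum_comm]
    refine Finset.sum_congr rfl fun i _ => ?_
    conv_lhs => rw [hq]
    simp only [Finset.sum_mul]
    exact Finset.sum_congr rfl fun j _ => by ring
  have hlhs : ∑ j, s j * Real.log (s j) - Real.log (Fintype.card κ) =
      ∑ j, s j * (Real.log (s j) - Real.log (Fintype.card κ)) := by
    simp only [mul_sub, Finset.sum_sub_distrib]
    rw [← Finset.sum_mul, hs1, one_mul]
  rw [hlhs, hsplit]
  refine Finset.sum_le_sum fun j _ => ?_
  rcases (hs j).eq_or_lt' with h0 | h0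
  · rw [h0]; simp
  · exact mul_le_mul_of_nonneg_left (hone j h0) h0.le

end Pinching

/-! ### Type classes of words. -/

section TypeCounting

variable {d l : ℕ}

/-- The number of occurrences of each letter in a word. -/
def letterCounts (i : Fin l → Fin d) : Fin d → Fin (l + 1) := fun a =>
  ⟨(Finset.univ.filter fun k => i k = a).card, Nat.lt_succ_of_le
    ((Finset.card_filter_le _ _).trans (by simp))⟩

/-- The reason for pinching by letter counts: `ρ^{⊗ l}` is scalar on each block, and the number of
labels is only polynomial in `l`. -/
theorem prod_eq_of_letterCounts_eq (r : Fin d → ℝ) {i j : Fin l → Fin d}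
    (h : letterCounts i = letterCounts j) : ∏ k, r (i k) = ∏ k, r (j k) := by
  have h1 : ∀ i : Fin l → Fin d, ∏ k, r (i k) = ∏ a, r a ^ (letterCounts i a : ℕ) := by
    intro i
    rw [← Finset.prod_fiberwise Finset.univ i]
    refine Finset.prod_congr rfl fun a _ => ?_
    rw [Finset.prod_congr rfl fun k hk => by rw [(Finset.mem_filter.mp hk).2], Finset.prod_const]
    rfl
  rw [h1, h1, h]

end TypeCounting

/-! ### Block measurements reach the relative entropy asymptotically. -/

section HiaiPetz

variable {d : ℕ}

theorem measuredEntropy_eq_sub {n X : Type} [Fintype n] [DecidableEq n] [Fintype X]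
    (M : PVM n X) {σ ρ : DensityMatrix n} (hac : OutcomesAC M σ ρ) :
    measuredEntropy M σ ρ = ∑ x, realProb M σ x * Real.log (realProb M σ x) -
      ∑ x, realProb M σ x * Real.log (realProb M ρ x) := by
  rw [measuredEntropy, ← Finset.sum_sub_distrib]
  refine Finset.sum_congr rfl fun x _ => ?_
  by_cases h : realProb M σ x = 0
  · rw [h]; simp
  · rw [Real.log_div h fun h1 => h (hac x h1), mul_sub]

theorem sum_prod_mul_log_prod {X : Type} [Fintype X] (a r : X → ℝ) (ha : ∑ x, a x = 1)
    (har : ∀ x, r x = 0 → a x = 0) (l : ℕ) :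
    ∑ x : Fin l → X, (∏ k, a (x k)) * Real.log (∏ k, r (x k)) =
      l * ∑ x, a x * Real.log (r x) := by
  rw [← sum_prod_mul_sum a (fun x => Real.log (r x)) ha l]
  refine Finset.sum_congr rfl fun x _ => ?_
  by_cases h : ∏ k, a (x k) = 0
  · rw [h, zero_mul, zero_mul]
  · rw [Real.log_prod fun k hk h1 => Finset.prod_ne_zero_iff.mp h k hk (har _ h1)]

theorem piMatrix_realDiagonal (l : ℕ) (f : Fin d → ℝ) :
    piMatrix (fun _ : Fin l => realDiagonal f) =
      realDiagonal fun i : Fin l → Fin d => ∏ k, f (i k) := by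
  unfold realDiagonal
  rw [piMatrix_diagonal (fun (_ : Fin l) i => ((f i : ℝ) : ℂ))]
  push_cast
  rfl

/-- A measurement of `l` copies in a common eigenbasis of `ρ^{⊗ l}` and of the pinched state
`σ^{⊗ l}` loses at most a logarithmic amount of relative entropy. -/
theorem exists_measuredEntropy_ge {σ ρ : DensityMatrix (Fin d)} (hfin : relEntropy σ ρ < ⊤)
    (l : ℕ) : ∃ M : PVM (Fin l → Fin d) (Fin l → Fin d),
      l * (relEntropy σ ρ).toReal - d * Real.log (l + 1) ≤
        measuredEntropy M (iidState l σ) (iidState l ρ) := by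
  obtain ⟨U, G, r, s, hU1, hU2, hG1, hG2, hr, hs, hr1, hs1, hρ, hσ, hsupp, hD⟩ :=
    exists_frame hfin
  set τ := G * realDiagonal s * Gᴴ with hτ
  set a : Fin d → ℝ := fun i => ∑ j, Complex.normSq (G i j) * s j with ha
  have hτa : ∀ i, τ i i = (a i : ℂ) := conj_realDiagonal_apply_self G s
  have har : ∀ i, r i = 0 → a i = 0 := fun i hi => Finset.sum_eq_zero fun j _ => hsupp i hi j
  have ha1 : ∑ i, a i = 1 := by
    rw [ha, Finset.sum_comm]
    simp only [← Finset.sum_mul, sum_normSq_col hG1, one_mul, hs1]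
  set Ul := piMatrix fun _ : Fin l => U
  set Gl := piMatrix fun _ : Fin l => G
  set rl : (Fin l → Fin d) → ℝ := fun i => ∏ k, r (i k)
  set sl : (Fin l → Fin d) → ℝ := fun i => ∏ k, s (i k)
  set A := piMatrix fun _ : Fin l => τ
  have hUl1 : Ulᴴ * Ul = 1 := by
    rw [piMatrix_conjTranspose, piMatrix_mul]; simp only [hU1, piMatrix_one]
  have hUl2 : Ul * Ulᴴ = 1 := mul_eq_one_comm.mp hUl1
  have hGl1 : Glᴴ * Gl = 1 := by
    rw [piMatrix_conjTranspose, piMatrix_mul]; simp only [hG1, piMatrix_one]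
  have hAs : A = Gl * realDiagonal sl * Glᴴ := by
    simp only [A, hτ, Gl, sl]
    rw [← piMatrix_realDiagonal, piMatrix_conjTranspose, piMatrix_mul, piMatrix_mul]
  have hσl : (iidState l σ).val = Ul * A * Ulᴴ := by
    change piMatrix (fun _ => σ.val) = _
    rw [piMatrix_conjTranspose, piMatrix_mul, piMatrix_mul, hσ]
  have hρl : (iidState l ρ).val = Ul * realDiagonal rl * Ulᴴ := by
    change piMatrix (fun _ => ρ.val) = _
    rw [← piMatrix_realDiagonal, piMatrix_conjTranspose, piMatrix_mul, piMatrix_mul, hρ]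
  have hAherm : A.IsHermitian := by
    have h1 : A = Ulᴴ * (iidState l σ).val * Ul := by
      rw [hσl, show Ulᴴ * (Ul * A * Ulᴴ) * Ul = (Ulᴴ * Ul) * A * (Ulᴴ * Ul) by
        simp only [Matrix.mul_assoc], hUl1, Matrix.one_mul, Matrix.mul_one]
    rw [h1]
    exact Matrix.isHermitian_conjTranspose_mul_mul _ (iidState l σ).posSemidef.isHermitian
  obtain ⟨W, hW1, hW2, hW0, hWA⟩ :=
    exists_block_diagonalization (letterCounts (d := d) (l := l)) hAherm
  -- `W` is block diagonal, so it commutes with every diagonal matrix that is constant on blocks: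
  -- with `ρ^{⊗ l}`, and in `hcross` with its logarithm. Rotating by `W` thus leaves the cross term
  -- equal to its i.i.d. value.
  have hcomm : ∀ f : (Fin l → Fin d) → ℝ,
      (∀ i j, letterCounts i = letterCounts j → f i = f j) →
      realDiagonal f * W = W * realDiagonal f := by
    intro f hf
    ext i j
    rw [mul_realDiagonal_apply, realDiagonal, Matrix.diagonal_mul, mul_comm]
    by_cases hij : letterCounts i = letterCounts j
    · rw [hf i j hij]
    · rw [hW0 i j hij, zero_mul, zero_mul]
  have hrl : ∀ i j, letterCounts i = letterCounts j → rl i = rl j :=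
    fun i j h => prod_eq_of_letterCounts_eq r h
  have hV1 : (Ul * W)ᴴ * (Ul * W) = 1 := by
    rw [Matrix.conjTranspose_mul, Matrix.mul_assoc, ← Matrix.mul_assoc Ulᴴ, hUl1, Matrix.one_mul,
      hW1]
  have hV2 : (Ul * W) * (Ul * W)ᴴ = 1 := mul_eq_one_comm.mp hV1
  have hconj : ∀ B, (Ul * W)ᴴ * (Ul * B * Ulᴴ) * (Ul * W) = Wᴴ * B * W := by
    intro B
    rw [Matrix.conjTranspose_mul, show Wᴴ * Ulᴴ * (Ul * B * Ulᴴ) * (Ul * W) =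
      Wᴴ * ((Ulᴴ * Ul) * B * (Ulᴴ * Ul)) * W by simp only [Matrix.mul_assoc], hUl1,
      Matrix.one_mul, Matrix.mul_one]
  set M := PVM.ofUnitary (Ul * W) hV1 hV2
  have hp : ∀ i, realProb M (iidState l ρ) i = rl i := by
    intro i
    rw [realProb_ofUnitary, hρl, hconj, Matrix.mul_assoc, hcomm rl hrl, ← Matrix.mul_assoc, hW1,
      Matrix.one_mul, realDiagonal, Matrix.diagonal_apply_eq, Complex.ofReal_re]
  have hE : ∀ B : Matrix (Fin l → Fin d) (Fin l → Fin d) ℂ,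
      Wᴴ * (Gl * B * Glᴴ) * W = (Wᴴ * Gl) * B * (Wᴴ * Gl)ᴴ := by
    intro B
    rw [Matrix.conjTranspose_mul, Matrix.conjTranspose_conjTranspose]
    simp only [Matrix.mul_assoc]
  have hE1 : (Wᴴ * Gl)ᴴ * (Wᴴ * Gl) = 1 := by
    rw [Matrix.conjTranspose_mul, Matrix.conjTranspose_conjTranspose, Matrix.mul_assoc,
      ← Matrix.mul_assoc W, hW2, Matrix.one_mul, hGl1]
  have hqdiag : ∀ i, (Wᴴ * A * W) i i =
      ((∑ j, Complex.normSq ((Wᴴ * Gl) i j) * sl j : ℝ) : ℂ) := by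
    intro i
    rw [hAs, hE, conj_realDiagonal_apply_self]
  have hq : ∀ i, realProb M (iidState l σ) i =
      ∑ j, Complex.normSq ((Wᴴ * Gl) i j) * sl j := by
    intro i
    rw [realProb_ofUnitary, hσl, hconj, hqdiag, Complex.ofReal_re]
  refine ⟨M, ?_⟩
  have hsl1 : ∑ j, sl j = 1 := by
    have h := Finset.prod_univ_sum (fun _ : Fin l => (Finset.univ : Finset (Fin d)))
      (fun _ i => s i)
    rw [Fintype.piFinset_univ] at h
    rw [← h]
    simp [hs1]
  have hpinch := sum_mul_log_pinching_ge (letterCounts (d := d) (l := l)) hE1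
    (fun j => Finset.prod_nonneg fun k _ => hs (j k)) hsl1 (fun i k hik hb => by
      rw [← hE, ← hAs]; exact hWA i k hik hb)
  have hcross : ∑ i, realProb M (iidState l σ) i * Real.log (rl i) =
      ∑ i : Fin l → Fin d, (∏ k, a (i k)) * Real.log (rl i) := by
    have h1 : (Wᴴ * A * W * realDiagonal fun i => Real.log (rl i)).trace =
        (A * realDiagonal fun i => Real.log (rl i)).trace := by
      rw [Matrix.mul_assoc, ← hcomm _ fun i j h => by rw [hrl i j h], ← Matrix.mul_assoc,
        Matrix.mul_assoc Wᴴ, Matrix.trace_mul_comm, ← Matrix.mul_assoc, hW2, Matrix.one_mul]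
    rw [trace_mul_realDiagonal, trace_mul_realDiagonal] at h1
    have h2 : ∀ i, A i i = ((∏ k, a (i k) : ℝ) : ℂ) := by
      intro i
      push_cast
      exact Finset.prod_congr rfl fun k _ => hτa (i k)
    simp only [hqdiag, h2, ← hq] at h1
    exact_mod_cast h1
  have hslog := sum_prod_mul_log_prod s s hs1 (fun _ h => h) l
  have harlog := sum_prod_mul_log_prod a r ha1 har l
  have hcard : Real.log (Fintype.card (Fin d → Fin (l + 1))) = d * Real.log (l + 1) := by
    rw [Fintype.card_fun, Fintype.card_fin, Fintype.card_fin]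
    push_cast
    rw [Real.log_pow]
  rw [measuredEntropy_eq_sub M (outcomesAC_of_relEntropy_lt_top M hfin)]
  simp only [hp]
  rw [hcross, harlog]
  simp only [hq]
  rw [hcard] at hpinch
  simp only [sl] at hpinch ⊢
  rw [hslog] at hpinch
  rw [hD]
  linarith

/-- Block measurements achieve every rate below the relative entropy. -/
theorem exists_lt_measuredEntropy {σ ρ : DensityMatrix (Fin d)} (hfin : relEntropy σ ρ < ⊤)
    {D : ℝ} (hD : D < (relEntropy σ ρ).toReal) : ∃ (l m : ℕ) (M : PVM (Fin l → Fin d) (Fin m)),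
      1 ≤ l ∧ l * D < measuredEntropy M (iidState l σ) (iidState l ρ) := by
  obtain ⟨l, hl, hlog⟩ : ∃ l : ℕ, 1 ≤ l ∧
      d * Real.log (l + 1) < l * ((relEntropy σ ρ).toReal - D) := by
    set c := (relEntropy σ ρ).toReal - D with hc
    have hc0 : 0 < c := by linarith
    -- With this constant the loss is at most `c / 2 * (l + 1)`, which is below `c * l` once `l ≥
    -- 2`.
    have h1 := (Real.isLittleO_log_id_atTop.def (c := c / (2 * (d + 1))) (by positivity))
    have h2 := (Filter.tendsto_atTop_add_const_right _ (1 : ℝ)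
      tendsto_natCast_atTop_atTop).eventually h1
    obtain ⟨l, hl1, hl2⟩ := (h2.and (Filter.eventually_ge_atTop 2)).exists
    have hl3 : (2 : ℝ) ≤ l := by exact_mod_cast hl2
    refine ⟨l, by omega, ?_⟩
    rw [id, Real.norm_of_nonneg (Real.log_nonneg (by linarith)),
      Real.norm_of_nonneg (by linarith)] at hl1
    have h3 : (d : ℝ) * Real.log (l + 1) ≤ (d + 1) * (c / (2 * (d + 1)) * (l + 1)) := by
      gcongr
      · exact Real.log_nonneg (by linarith)
      · linarith
    have h4 : ((d : ℝ) + 1) * (c / (2 * (d + 1)) * (l + 1)) = c / 2 * (l + 1) := by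
      field_simp
    nlinarith
  obtain ⟨M, hM⟩ := exists_measuredEntropy_ge hfin l
  refine ⟨l, Fintype.card (Fin l → Fin d), M.relabel (Fintype.equivFin _).symm, hl, ?_⟩
  rw [measuredEntropy_relabel]
  linarith

end HiaiPetz

/-! ### Measurements that do not depend on the post-change state. -/

section Selection

variable {d : ℕ}

/-- A block measurement with finitely many outcomes, together with its block length. -/
abbrev BlockMeasurement (d : ℕ) : Type := Σ l : ℕ, Σ m : ℕ, PVM (Fin l → Fin d) (Fin m)

/-- A continuous extension to all matrices of the measured relative entropy with respect to
`ρ^{⊗ l}` of the state `σ^{⊗ l}`. -/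
noncomputable def entropyFunctional (ρ : DensityMatrix (Fin d)) (B : BlockMeasurement d)
    (A : Matrix (Fin d) (Fin d) ℂ) : ℝ :=
  ∑ x, (-Real.negMulLog (B.2.2.proj x * tensorMatrix fun _ : Fin B.1 => A).trace.re -
    (B.2.2.proj x * tensorMatrix fun _ : Fin B.1 => A).trace.re *
      Real.log (realProb B.2.2 (iidState B.1 ρ) x))

/-- The function x log x is continuous also at 0, and the other logarithm involves `ρ` only, so it
is a constant coefficient. Continuity makes the sets where a given rate is exceeded open. -/
theorem continuous_entropyFunctional (ρ : DensityMatrix (Fin d)) (B : BlockMeasurement d) :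
    Continuous (entropyFunctional ρ B) := by
  have h1 : Continuous fun A : Matrix (Fin d) (Fin d) ℂ => tensorMatrix fun _ : Fin B.1 => A :=
    continuous_matrix fun i j => continuous_finsetProd _ fun k _ =>
      continuous_id.matrix_elem (i k) (j k)
  have h2 : ∀ x, Continuous fun A : Matrix (Fin d) (Fin d) ℂ =>
      (B.2.2.proj x * tensorMatrix fun _ : Fin B.1 => A).trace.re := fun x =>
    Complex.continuous_re.comp (continuous_const.matrix_mul h1).matrix_trace
  exact continuous_finsetSum _ fun x _ =>
    (Real.continuous_negMulLog.comp (h2 x)).neg.sub ((h2 x).mul continuous_const)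

theorem entropyFunctional_eq {σ ρ : DensityMatrix (Fin d)} (hfin : relEntropy σ ρ < ⊤)
    (B : BlockMeasurement d) :
    entropyFunctional ρ B σ.val = measuredEntropy B.2.2 (iidState B.1 σ) (iidState B.1 ρ) := by
  rw [measuredEntropy_eq_sub _ (outcomesAC_of_relEntropy_lt_top B.2.2 hfin),
    ← Finset.sum_sub_distrib]
  refine Finset.sum_congr rfl fun x _ => ?_
  rw [Real.negMulLog, neg_mul, neg_neg]
  rfl

/-- Countably many block measurements achieve all rates below the relative entropy for all
states simultaneously. -/
theorem exists_seq_lt_measuredEntropy (ρ : DensityMatrix (Fin d)) :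
    ∃ B : ℕ → BlockMeasurement d, ∀ σ : DensityMatrix (Fin d), relEntropy σ ρ < ⊤ →
      ∀ D : ℝ, D < (relEntropy σ ρ).toReal → ∃ n, 1 ≤ (B n).1 ∧
        (B n).1 * D < measuredEntropy (B n).2.2 (iidState (B n).1 σ) (iidState (B n).1 ρ) := by
  let V : ℚ → {B : BlockMeasurement d // 1 ≤ B.1} → Set (Matrix (Fin d) (Fin d) ℂ) :=
    fun a B => {A | B.1.1 * (a : ℝ) < entropyFunctional ρ B.1 A}
  have hV : ∀ a B, IsOpen (V a B) := fun a B =>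
    isOpen_lt continuous_const (continuous_entropyFunctional ρ B.1)
  have : SecondCountableTopology (Matrix (Fin d) (Fin d) ℂ) :=
    inferInstanceAs (SecondCountableTopology (Fin d → Fin d → ℂ))
  -- For each rational rate `a`, countably many measurements already cover every matrix on which
  -- some measurement exceeds `a`. Taking the union over rational `a` keeps the family countable.
  choose S hS hSV using fun a => TopologicalSpace.isOpen_iUnion_countable (V a) (hV a)
  have : Nonempty {B : BlockMeasurement d // 1 ≤ B.1} := ⟨⟨⟨1, 1, PVM.trivial⟩, le_rfl⟩⟩
  obtain ⟨f, hf⟩ := Set.countable_iff_exists_subset_range.mp (Set.countable_iUnion hS)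
  refine ⟨fun n => (f n).1, fun σ hσ D hD => ?_⟩
  obtain ⟨a, hDa, haD⟩ := exists_rat_btwn hD
  obtain ⟨l, m, M, hl, hM⟩ := exists_lt_measuredEntropy hσ haD
  have h1 : σ.val ∈ ⋃ B, V a B := Set.mem_iUnion.mpr ⟨⟨⟨l, m, M⟩, hl⟩, by
    change (l : ℝ) * a < _
    rw [entropyFunctional_eq hσ]
    exact hM⟩
  rw [← hSV a] at h1
  simp only [Set.mem_iUnion] at h1
  obtain ⟨B, hB, hBσ⟩ := h1
  obtain ⟨n, rfl⟩ := hf (Set.mem_iUnion.mpr ⟨a, hB⟩)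
  refine ⟨n, (f n).2, ?_⟩
  have h2 : (f n).1.1 * (a : ℝ) < entropyFunctional ρ (f n).1 σ.val := hBσ
  rw [entropyFunctional_eq hσ] at h2
  have h3 : (0 : ℝ) < (f n).1.1 := by exact_mod_cast (f n).2
  exact lt_trans (mul_lt_mul_of_pos_left hDa h3) h2

/-- One block measurement for each block length achieves all rates below the relative entropy for
all states simultaneously. -/
theorem exists_measurements_lt_measuredEntropy (ρ : DensityMatrix (Fin d)) :
    ∃ (m : ℕ → ℕ) (M : ∀ l, PVM (Fin l → Fin d) (Fin (m l))),
      ∀ σ : DensityMatrix (Fin d), relEntropy σ ρ < ⊤ →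
      ∀ D : ℝ, D < (relEntropy σ ρ).toReal → ∃ l : ℕ, 1 ≤ l ∧
        l * D < measuredEntropy (M l) (iidState l σ) (iidState l ρ) := by
  obtain ⟨B, hB⟩ := exists_seq_lt_measuredEntropy ρ
  -- Every positive block length has arbitrarily large multiples, so a strictly increasing `φ` can
  -- choose a multiple of the length of `B n` for each `n`. Its injectivity lets each length `L`
  -- serve at most one `n`; unused lengths get the trivial measurement.
  have hfreq : ∀ n, ∃ᶠ k in Filter.atTop, 1 ≤ (B n).1 → ∃ r : ℕ, 1 ≤ r ∧ k = r * (B n).1 := by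
    intro n
    rw [Filter.frequently_atTop]
    intro a
    by_cases hn : 1 ≤ (B n).1
    · exact ⟨(a + 1) * (B n).1, by nlinarith, fun _ => ⟨a + 1, by omega, rfl⟩⟩
    · exact ⟨a, le_rfl, fun h => absurd h hn⟩
  obtain ⟨φ, hφ, hφB⟩ := Filter.extraction_forall_of_frequently hfreq
  have hsel : ∀ L : ℕ, ∃ N : Σ m : ℕ, PVM (Fin L → Fin d) (Fin m), ∀ n, φ n = L →
      1 ≤ (B n).1 → ∀ σ : DensityMatrix (Fin d), relEntropy σ ρ < ⊤ → ∀ D : ℝ,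
        (B n).1 * D < measuredEntropy (B n).2.2 (iidState (B n).1 σ) (iidState (B n).1 ρ) →
          1 ≤ L ∧ L * D < measuredEntropy N.2 (iidState L σ) (iidState L ρ) := by
    intro L
    by_cases hL : ∃ n, φ n = L ∧ 1 ≤ (B n).1
    · obtain ⟨n, hn, hl⟩ := hL
      obtain ⟨r, hr, hrl⟩ := hφB n hl
      rw [hn] at hrl
      subst hrl
      refine ⟨⟨_, ((B n).2.2.pow r).relabel (Fintype.equivFin _).symm⟩,
        fun n' hn' _ σ hσ D hD => ?_⟩
      obtain rfl := hφ.injective (hn'.trans hn.symm)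
      refine ⟨Nat.mul_pos hr hl, ?_⟩
      rw [measuredEntropy_relabel,
        measuredEntropy_pow _ _ (outcomesAC_of_relEntropy_lt_top _ hσ), Nat.cast_mul, mul_assoc]
      exact mul_lt_mul_of_pos_left hD (by exact_mod_cast hr)
    · exact ⟨⟨1, PVM.trivial⟩, fun n hn hl => absurd ⟨n, hn, hl⟩ hL⟩
  choose N hN using hsel
  refine ⟨fun l => (N l).1, fun l => (N l).2, fun σ hσ D hD => ?_⟩
  obtain ⟨n, hn, hlt⟩ := hB σ hσ D hD
  exact ⟨φ n, hN _ n rfl hn σ hσ D hlt⟩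

end Selection

end QuantumChangePoint

/-- Achievability. For each `ρ` there are block measurements `M l`, one for each block length `l`
and depending on `ρ` only, such that for every post-change state `σ ≠ ρ` with `D(σ‖ρ) < ∞` and
every `0 < ε < 1`, for a suitable block length `l`, the QUSUM algorithms with measurement `M l`
satisfy `τ* ≤ log T_FA / (D(σ‖ρ) (1 - ε)) + O(1)`: both with `T_FA` the mean false alarm time of
the algorithm itself, for every threshold, and with `T_FA` any large enough prescribed lower bound
on the mean false alarm time, for a suitable threshold. -/
theorem theorem1 (d : ℕ) (ρ : QuantumChangePoint.DensityMatrix (Fin d)) :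
    ∃ (m : ℕ → ℕ) (M : ∀ l : ℕ, QuantumChangePoint.PVM (Fin l → Fin d) (Fin (m l))),
      ∀ (σ : QuantumChangePoint.DensityMatrix (Fin d)), σ ≠ ρ →
        QuantumChangePoint.relEntropy σ ρ < ⊤ →
        ∀ ε : ℝ, 0 < ε → ε < 1 →
          ∃ (l : ℕ) (C T₀ : ℝ), 1 ≤ l ∧
            (∀ h : ℝ, 0 ≤ h →
              QuantumChangePoint.meanFalseAlarmTime (M l) ρ σ h < ⊤ ∧
              (QuantumChangePoint.worstMeanDelay (M l) ρ σ h : EReal) ≤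
                ((Real.log (QuantumChangePoint.meanFalseAlarmTime (M l) ρ σ h).toReal /
                  ((QuantumChangePoint.relEntropy σ ρ).toReal * (1 - ε)) + C : ℝ) : EReal)) ∧
            (∀ T : ℝ, T₀ ≤ T → ∃ h : ℝ, 0 ≤ h ∧
              ENNReal.ofReal T ≤ QuantumChangePoint.meanFalseAlarmTime (M l) ρ σ h ∧
              (QuantumChangePoint.worstMeanDelay (M l) ρ σ h : EReal) ≤
                ((Real.log T /
                  ((QuantumChangePoint.relEntropy σ ρ).toReal * (1 - ε)) + C : ℝ) : EReal)) := by
  obtain ⟨m, M, hM⟩ := QuantumChangePoint.exists_measurements_lt_measuredEntropy ρ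
  refine ⟨m, M, fun σ hne hfin ε hε0 hε1 => ?_⟩
  have hD := QuantumChangePoint.relEntropy_pos hfin hne
  -- This target rate is strictly below the relative entropy because the latter is positive, which
  -- is where `σ ≠ ρ` enters.
  obtain ⟨l, hl, hlt⟩ := hM σ hfin ((QuantumChangePoint.relEntropy σ ρ).toReal * (1 - ε))
    (by nlinarith)
  obtain ⟨C, T₀, h1, h2⟩ := QuantumChangePoint.exists_constants
    (QuantumChangePoint.outcomesAC_of_relEntropy_lt_top (M l) hfin) hl
    (mul_pos hD (by linarith)) hlt.le
  exact ⟨l, C, T₀, hl, h1, h2⟩
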